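/- Let $X$ be an infinite linearly ordered set that is ultrahomogeneous: for every $n$ and all $x_1<\dots<x_n$, $y_1<\dots<y_n$ in $X$ some order automorphism $g$ of $X$ satisfies $g(x_k)=y_k$ for all $k$. Let $G=\mathrm{Aut}(X)$ be its group of order automorphisms with the permutation topology $\tau_\partial$ (pointwise convergence on the discrete set $X$). Let $b_mX$ be the linearly ordered set obtained from the lexicographic product $X\times\{-1,0,1\}$ by filling each gap, including the two improper ones, with one point, in its order topology (a compact space); $\inf$ and $\sup$ are its least and greatest elements, and $x\in X$ is identified with $(x,0)$. $G$ acts on $b_mX$ by $g(x,j)=(gx,j)$ and $g(A,B)=(gA,gB)$ for gaps $(A,B)$. If $G$ acts by homeomorphisms on a compact space $K$, let $e_KG$ be the closure of the set of maps $k\mapsto gk$, $g\in G$, in $K^K$ with the topology of pointwise convergence. A compactification of $G$ is a compact Hausdorff space with a dense topological embedding of $G$; $(K,b)\le(K',b')$ means that there is a continuous $\varphi:K'\to K$ with $\varphi\circ b'=b$, and compactifications are equal if there is a homeomorphism between them respecting the embeddings. A $G$-compactification of $G$ is a compactification to which the action of $G$ on itself by left multiplication extends continuously; it is an Ellis compactification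 if it is moreover a monoid in which all maps $x\mapsto xy$ are continuous and multiplication on the left by elements of $G$ is the extended action. Let $b_rG$ be the Roelcke compactification of $G$, i.e. the completion of $G$ in the finest totally bounded uniformity coarser than the Roelcke uniformity $L\wedge R$ (with base of covers $\{OgO: g\in G\}$, $O$ a neighbourhood of the unit); it carries the extended left action of $G$, and $\mathfrak E(b_rG):=e_{b_rG}G$. Let $R_{\Sigma_{b_mX}}$ be the uniformity on $G$ with base of covers $\{Og\,\mathrm{St}_\sigma: g\in G\}$, where $O$ is a neighbourhood of the unit and $\mathrm{St}_\sigma$ is the pointwise stabilizer of a finite set $\sigma\subset b_mX$. Then $b_rG$ is a $G$-compactification of $G$, $e_{b_mX}G$ with composition of maps is an Ellis compactification of $G$, and: (a) $e_{b_mX}G$ is the completion of $(G,R_{\Sigma_{b_mX}})$; (b) $G$ is Roelcke precompact (that is, $L\wedge R$ is totally bounded), $b_rG\le e_{b_mX}G$, and $\mathfrak E(b_rG)=e_{b_mX}G$; (c) $e_{b_mX}G$ is the set of self-maps $f$ of $b_mX$, in the topology of pointwise convergence, such that (i) $x<y$ implies $f(x)\le f(y)$; (ii) $f(x)\notin X$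 if $x\in b_mX\setminus X$; (iii) if $f(x)=f(y)$ and $x\ne y$, then $f(x)\in b_mX\setminus X$; (iv) for each $x\in X$, either $f((x,-1))=f((x,0))=f((x,1))\notin X$, or there is $y\in X$ with $f((x,j))=(y,j)$ for $j=-1,0,1$; (v) $f(\inf)=\inf$ and $f(\sup)=\sup$; (d) $b_rG$ is (with $g\in G$ corresponding to the map $x\mapsto(gx,0)$) the set of maps $f:X\to b_mX$, in the topology of pointwise convergence, such that $x<y$ implies $f(x)\le f(y)$, and if $f(x)=f(y)$ with $x\ne y$ then $f(x)\in b_mX\setminus X$. If $X$ is continuously ordered (densely ordered and without proper gaps), then $b_rG=e_{b_mX}G$. -/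

import Mathlib

open Set Topology

/-! ### Uniformities on a topological group -/

section Uniformities

variable {G : Type*} [Group G]

/-- The entourage `{(g, h) | h ∈ O g P}` determined by two sets `O`, `P` of group elements. -/
def doubleEntourage (O P : Set G) : Set (G × G) :=
  {p | ∃ a ∈ O, ∃ b ∈ P, p.2 = a * p.1 * b}

theorem doubleEntourage_mono {O O' P P' : Set G} (hO : O ⊆ O') (hP : P ⊆ P') :
    doubleEntourage O P ⊆ doubleEntourage O' P' := by
  rintro p ⟨a, ha, b, hb, h⟩
  exact ⟨a, hO ha, b, hP hb, h⟩

theorem doubleEntourage_refl {O P : Set G} (hO : 1 ∈ O) (hP : 1 ∈ P) (g : G) :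
    (g, g) ∈ doubleEntourage O P :=
  ⟨1, hO, 1, hP, by simp⟩

theorem doubleEntourage_symm {O O' P P' : Set G} (hO : ∀ a ∈ O', a⁻¹ ∈ O)
    (hP : ∀ b ∈ P', b⁻¹ ∈ P) :
    doubleEntourage O' P' ⊆ Prod.swap ⁻¹' doubleEntourage O P := by
  rintro ⟨g, h⟩ ⟨a, ha, b, hb, e⟩
  refine ⟨a⁻¹, hO a ha, b⁻¹, hP b hb, ?_⟩
  simp only [Prod.swap] at e ⊢
  rw [e]; group

theorem doubleEntourage_comp {O O' P P' : Set G} (hO : ∀ a ∈ O', ∀ b ∈ O', a * b ∈ O)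
    (hP : ∀ a ∈ P', ∀ b ∈ P', a * b ∈ P) {g h k : G}
    (h₁ : (g, h) ∈ doubleEntourage O' P') (h₂ : (h, k) ∈ doubleEntourage O' P') :
    (g, k) ∈ doubleEntourage O P := by
  obtain ⟨a, ha, b, hb, e⟩ := h₁
  obtain ⟨c, hc, d, hd, e'⟩ := h₂
  refine ⟨c * a, hO c hc a ha, b * d, hP b hb d hd, ?_⟩
  simp only at e e' ⊢
  rw [e', e]; group

variable (G) [TopologicalSpace G] [IsTopologicalGroup G]

/-- The Roelcke uniformity `L ∧ R`: the entourages `{(g, h) | h ∈ O g O}`, `O` a neighbourhood of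
the unit, form a base of it. -/
@[reducible] def roelckeUniformity : UniformSpace G :=
  UniformSpace.ofCore <| UniformSpace.Core.mkOfBasis
    { sets := {W | ∃ O ∈ 𝓝 (1 : G), W = doubleEntourage O O}
      nonempty := ⟨_, univ, Filter.univ_mem, rfl⟩
      inter_sets := by
        rintro _ _ ⟨O, hO, rfl⟩ ⟨O', hO', rfl⟩
        exact ⟨_, ⟨O ∩ O', Filter.inter_mem hO hO', rfl⟩,
          subset_inter (doubleEntourage_mono inter_subset_left inter_subset_left)
            (doubleEntourage_mono inter_subset_right inter_subset_right)⟩ }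
    (by
      rintro _ ⟨O, hO, rfl⟩ g
      exact doubleEntourage_refl (mem_of_mem_nhds hO) (mem_of_mem_nhds hO) g)
    (by
      rintro _ ⟨O, hO, rfl⟩
      refine ⟨_, ⟨O⁻¹, inv_mem_nhds_one G hO, rfl⟩, ?_⟩
      exact doubleEntourage_symm (fun a ha => ha) (fun a ha => ha))
    (by
      rintro _ ⟨O, hO, rfl⟩
      obtain ⟨V, hV, hVO⟩ := exists_nhds_one_split hO
      refine ⟨_, ⟨V, hV, rfl⟩, ?_⟩
      rintro ⟨g, k⟩ ⟨h, h₁, h₂⟩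
      exact doubleEntourage_comp hVO hVO h₁ h₂)

/-- The uniformity `R_Σ` on `G` determined by an action of `G` on a set `Y`: the entourages
`{(g, h) | h ∈ O g St_σ}` form a base of it, where `O` is a neighbourhood of the unit and `St_σ` is
the pointwise stabilizer of a finite set `σ ⊆ Y`. -/
@[reducible] def stabilizerUniformity (Y : Type*) [MulAction G Y] : UniformSpace G :=
  UniformSpace.ofCore <| UniformSpace.Core.mkOfBasis
    { sets := {W | ∃ O ∈ 𝓝 (1 : G), ∃ σ : Finset Y,
        W = doubleEntourage O (fixingSubgroup G (σ : Set Y) : Set G)}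
      nonempty := ⟨_, univ, Filter.univ_mem, ∅, rfl⟩
      inter_sets := by
        classical
        rintro _ _ ⟨O, hO, σ, rfl⟩ ⟨O', hO', σ', rfl⟩
        refine ⟨_, ⟨O ∩ O', Filter.inter_mem hO hO', σ ∪ σ', rfl⟩,
          subset_inter (doubleEntourage_mono inter_subset_left ?_)
            (doubleEntourage_mono inter_subset_right ?_)⟩
        · exact fixingSubgroup_antitone G Y (by simp)
        · exact fixingSubgroup_antitone G Y (by simp) }
    (by
      rintro _ ⟨O, hO, σ, rfl⟩ g
      exact doubleEntourage_refl (mem_of_mem_nhds hO) (one_mem _) g)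
    (by
      rintro _ ⟨O, hO, σ, rfl⟩
      refine ⟨_, ⟨O⁻¹, inv_mem_nhds_one G hO, σ, rfl⟩, ?_⟩
      exact doubleEntourage_symm (fun a ha => ha) (fun a ha => inv_mem ha))
    (by
      rintro _ ⟨O, hO, σ, rfl⟩
      obtain ⟨V, hV, hVO⟩ := exists_nhds_one_split hO
      refine ⟨_, ⟨V, hV, σ, rfl⟩, ?_⟩
      rintro ⟨g, k⟩ ⟨h, h₁, h₂⟩
      exact doubleEntourage_comp hVO (fun a ha b hb => mul_mem ha hb) h₁ h₂)

/-- `G` is Roelcke precompact if its Roelcke uniformity is totally bounded. -/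
def IsRoelckePrecompact : Prop :=
  @TotallyBounded G (roelckeUniformity G) univ

/-- The precompact replica of a uniformity: the finest totally bounded uniformity coarser than
it. -/
@[reducible] def precompactReplica {Y : Type*} (U : UniformSpace Y) : UniformSpace Y :=
  sInf {V | U ≤ V ∧ @TotallyBounded Y V univ}

/-- The Roelcke compactification `b_r G`: the Samuel compactification of `G` with its Roelcke
uniformity, i.e. the Hausdorff completion of `G` in the precompact replica of that uniformity. -/
def RoelckeCompactification : Type _ :=
  @UniformSpace.Completion G (precompactReplica (roelckeUniformity G))

noncomputable instance : UniformSpace (RoelckeCompactification G) :=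
  @UniformSpace.Completion.uniformSpace G (precompactReplica (roelckeUniformity G))

variable {G}

/-- The canonical map `G → b_r G`. -/
def toRoelcke (g : G) : RoelckeCompactification G :=
  @UniformSpace.Completion.coe' G (precompactReplica (roelckeUniformity G)) g

/-- The extension to `b_r G` of the action of `G` on itself by left multiplication. -/
noncomputable def roelckeAct (g : G) : RoelckeCompactification G → RoelckeCompactification G :=
  @UniformSpace.Completion.map G (precompactReplica (roelckeUniformity G)) G
    (precompactReplica (roelckeUniformity G)) (fun h => g * h)

end Uniformities

/-! ### Compactifications -/

section Compactifications

/-- `(K, i)` is the (Hausdorff) completion of the uniform space `(Y, U)`: the topology of `K` is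
induced by a complete separated uniformity for which `i` identifies `(Y, U)` with a dense uniform
subspace of `K`. -/
def IsCompletionOf {Y K : Type*} (U : UniformSpace Y) [tK : TopologicalSpace K] (i : Y → K) :
    Prop :=
  ∃ V : UniformSpace K, V.toTopologicalSpace = tK ∧ CompleteSpace K ∧ T0Space K ∧
    Function.Injective i ∧ @IsUniformInducing Y K U V i ∧ DenseRange i

/-- `(K, i)` is a proper `G`-compactification of `G` (acting on itself by left multiplication),
`ρ` being the extended action. -/
structure IsGCompactification {G K : Type*} [Group G] [TopologicalSpace G] [TopologicalSpace K]
    (i : G → K) (ρ : G → K → K) : Prop where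
  compact : CompactSpace K
  t2 : T2Space K
  isDenseEmbedding : IsDenseEmbedding i
  one_act : ∀ k, ρ 1 k = k
  mul_act : ∀ g h k, ρ (g * h) k = ρ g (ρ h k)
  act_map : ∀ g h, ρ g (i h) = i (g * h)
  continuous_act : Continuous fun p : G × K => ρ p.1 p.2

/-- `(K, i)` is an Ellis compactification of `G`: a `G`-compactification that is a right topological
monoid (`x ↦ x * y` is continuous for every `y`), in which multiplication by elements of `G` on the
left is the extended action. -/
structure IsEllisCompactification {G K : Type*} [Group G] [TopologicalSpace G]
    [TopologicalSpace K] [Monoid K] (i : G → K) : Prop where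
  isGCompactification : IsGCompactification i fun g k => i g * k
  continuous_mul_right : ∀ y : K, Continuous fun x : K => x * y

/-- The order on compactifications (more generally, on spaces under `Y`): `(K, b) ≤ (K', b')` if
there is a continuous `φ : K' → K` with `φ ∘ b' = b`. -/
def CompactificationLE {Y K K' : Type*} [TopologicalSpace K] [TopologicalSpace K'] (b : Y → K)
    (b' : Y → K') : Prop :=
  ∃ φ : K' → K, Continuous φ ∧ ∀ y, φ (b' y) = b y

/-- Equality of compactifications: there is a homeomorphism respecting the maps from `Y`. -/
def CompactificationEq {Y K K' : Type*} [TopologicalSpace K] [TopologicalSpace K'] (b : Y → K)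
    (b' : Y → K') : Prop :=
  ∃ φ : K ≃ₜ K', ∀ y, φ (b y) = b' y

/-- The enveloping semigroup `e_K G` of an action `ρ` of `G` on a space `K`: the closure, in the
space `K → K` of self-maps with the topology of pointwise convergence, of the set of maps
`ρ g`, `g ∈ G`. -/
def envelope {G K : Type*} [TopologicalSpace K] (ρ : G → K → K) : Set (K → K) :=
  closure (range ρ)

/-- The canonical map `G → e_K G`. -/
def toEnvelope {G K : Type*} [TopologicalSpace K] (ρ : G → K → K) (g : G) : envelope ρ :=
  ⟨ρ g, subset_closure ⟨g, rfl⟩⟩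

end Compactifications

/-! ### Chains and their automorphism groups -/

section Chains

variable (X : Type*) [LinearOrder X]

/-- Any two strictly increasing `n`-tuples are conjugate under an automorphism, for every `n`. -/
def IsUltrahomogeneous : Prop :=
  ∀ (n : ℕ) (x y : Fin n → X), StrictMono x → StrictMono y → ∃ g : X ≃o X, ∀ k, g (x k) = y k

/-- `(A, B)` is a proper gap of the chain: a cut with nonempty parts such that `A` has no greatest
and `B` no least element. -/
structure IsProperGap {X : Type*} [LinearOrder X] (A B : Set X) : Prop where
  nonempty_left : A.Nonempty
  nonempty_right : B.Nonempty
  union_eq : A ∪ B = univ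
  lt : ∀ a ∈ A, ∀ b ∈ B, a < b
  no_greatest : ¬ ∃ a, IsGreatest A a
  no_least : ¬ ∃ b, IsLeast B b

/-- A continuously ordered chain: densely ordered, without proper gaps. -/
def IsContinuouslyOrdered : Prop :=
  DenselyOrdered X ∧ ∀ A B : Set X, ¬ IsProperGap A B

/-- The permutation topology on `Aut X`: the topology of pointwise convergence for the action on the
discrete space `X`. -/
instance permutationTopology : TopologicalSpace (X ≃o X) :=
  TopologicalSpace.induced (fun (g : X ≃o X) (x : X) => g x)
    (@Pi.topologicalSpace X (fun _ => X) fun _ => ⊥)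

variable {X}

theorem isOpen_setOf_apply_eq (x y : X) : IsOpen {g : X ≃o X | g x = y} := by
  let _ : TopologicalSpace X := ⊥
  have : DiscreteTopology X := ⟨rfl⟩
  have h : Continuous fun g : X ≃o X => g x :=
    (continuous_apply x).comp (continuous_induced_dom (f := fun (g : X ≃o X) (x : X) => g x))
  exact (isOpen_discrete {y}).preimage h

theorem continuous_to_aut {T : Type*} [TopologicalSpace T] {f : T → (X ≃o X)}
    (h : ∀ x t, ∀ᶠ s in 𝓝 t, f s x = f t x) : Continuous f := by
  let _ : TopologicalSpace X := ⊥
  have : DiscreteTopology X := ⟨rfl⟩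
  refine continuous_induced_rng.2 (continuous_pi fun x => continuous_iff_continuousAt.2 fun t => ?_)
  exact tendsto_nhds_of_eventually_eq (h x t)

instance : IsTopologicalGroup (X ≃o X) where
  continuous_mul := continuous_to_aut fun x t => by
    have h₁ : ∀ᶠ s : (X ≃o X) × (X ≃o X) in 𝓝 t, s.2 x = t.2 x :=
      continuous_snd.continuousAt.eventually ((isOpen_setOf_apply_eq x (t.2 x)).mem_nhds rfl)
    have h₂ : ∀ᶠ s : (X ≃o X) × (X ≃o X) in 𝓝 t, s.1 (t.2 x) = t.1 (t.2 x) :=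
      continuous_fst.continuousAt.eventually
        ((isOpen_setOf_apply_eq (t.2 x) (t.1 (t.2 x))).mem_nhds rfl)
    filter_upwards [h₁, h₂] with s hs₁ hs₂
    rw [RelIso.mul_apply, RelIso.mul_apply, hs₁, hs₂]
  continuous_inv := continuous_to_aut fun x t => by
    have h : ∀ᶠ s : X ≃o X in 𝓝 t, s (t⁻¹ x) = x :=
      (isOpen_setOf_apply_eq (t⁻¹ x) x).mem_nhds (RelIso.apply_inv_self t x)
    filter_upwards [h] with s hs
    calc s⁻¹ x = s⁻¹ (s (t⁻¹ x)) := by rw [hs]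
      _ = t⁻¹ x := RelIso.inv_apply_self s _

/-! ### The compactification `b_m X` -/

variable (X) in
/-- The least linearly ordered compactification `b_m X` of the discrete chain `X`: every gap
(including the improper ones) of the lexicographic product `X ×ₗ {-1, 0, 1}` is filled by one point.
For a linear order this is the Dedekind–MacNeille completion: a Dedekind cut is either principal,
i.e. given by a point, or consists of the two parts of a gap. The least element `inf` is `⊥`, the
greatest element `sup` is `⊤`. -/
abbrev BMax := DedekindCut (X ×ₗ SignType)

/-- `b_m X` carries the topology of its linear order. -/
instance : TopologicalSpace (BMax X) := Preorder.topology _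

instance : OrderTopology (BMax X) := ⟨rfl⟩

/-- The point `(x, j)` of `b_m X`. -/
def BMax.pt (x : X) (j : SignType) : BMax X := DedekindCut.principal (toLex (x, j))

/-- The image `X × {0}` of the chain `X` in `b_m X`. -/
def BMax.base : Set (BMax X) := range fun x : X => BMax.pt x 0

/-- The map `(x, j) ↦ (g x, j)`. -/
def lexAut (g : X ≃o X) : X ×ₗ SignType ≃o X ×ₗ SignType :=
  Prod.Lex.prodLexCongr g (OrderIso.refl SignType)

/-- `Aut X` acts on `b_m X` by moving cuts, `g (A, B) = (g A, g B)`. -/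
instance : MulAction (X ≃o X) (BMax X) where
  smul g c :=
    { extent := lexAut g '' c.extent
      intent := lexAut g '' c.intent
      upperPolar_extent := by
        rw [upperPolar_le, OrderIso.upperBounds_image, ← upperPolar_le, c.upperPolar_extent]
      lowerPolar_intent := by
        rw [lowerPolar_le, OrderIso.lowerBounds_image, ← lowerPolar_le, c.lowerPolar_intent] }
  one_smul c := Concept.ext (image_id _)
  mul_smul g h c := Concept.ext (image_comp (lexAut g) (lexAut h) c.extent)

theorem BMax.smul_pt (g : X ≃o X) (x : X) (j : SignType) :
    g • BMax.pt x j = BMax.pt (g x) j :=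
  Concept.ext (OrderIso.image_Iic (lexAut g) (toLex (x, j)))

/-- The action of `Aut X` on `b_m X`, as a family of self-maps. -/
def bmAct (g : X ≃o X) : BMax X → BMax X := fun p => g • p

variable (X) in
/-- The explicit conditions on a self-map of `b_m X` that describe `e_{b_m X} G`: it is monotone,
does not map points off `X` into `X`, identifies distinct points only to points off `X`, on each
triple `(x, -1), (x, 0), (x, 1)` is either constant with value off `X` or maps it to the triple of
some `y`, and fixes `inf` and `sup`. -/
structure IsEnvelopeMap (f : BMax X → BMax X) : Prop where
  monotone : ∀ p q, p < q → f p ≤ f q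
  map_compl : ∀ p, p ∉ BMax.base → f p ∉ BMax.base
  eq_imp : ∀ p q, p ≠ q → f p = f q → f p ∉ BMax.base
  triples : ∀ x : X,
    (f (.pt x (-1)) = f (.pt x 0) ∧ f (.pt x 0) = f (.pt x 1) ∧ f (.pt x 0) ∉ BMax.base) ∨
    ∃ y : X, f (.pt x (-1)) = .pt y (-1) ∧ f (.pt x 0) = .pt y 0 ∧ f (.pt x 1) = .pt y 1
  map_bot : f ⊥ = ⊥
  map_top : f ⊤ = ⊤

/-- The explicit conditions on a map `X → b_m X` that describe `b_r G`: it is monotone and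
identifies distinct points only to points off `X`. -/
structure IsRoelckeMap (f : X → BMax X) : Prop where
  monotone : ∀ x y, x < y → f x ≤ f y
  eq_imp : ∀ x y, x ≠ y → f x = f y → f x ∉ BMax.base

end Chains

/-! Ultrahomogeneity makes `X` dense without endpoints and extends every finite strictly increasing
partial map to an automorphism. In `b_m X` the points `(x, 0)` are isolated and dense, their open
rays are clopen, and the triple of a moving point shrinks to one point whenever its middle point
converges off `X`.

Description of the closures. Monotonicity survives pointwise limits, and isolation of `(z, 0)`
prevents distinct points from merging there. Conversely, a monotone map merging points only off `X`
is approximated on a finite set by strictly increasing tuples, which automorphisms realise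
(`closure_range_ofAut`). For self-maps `f` of `b_m X`, a finite set of arguments is reduced to this
case by a Roelcke map `r` that sends points of `X` on both sides of each gap onto that gap:
automorphisms approximating `f ∘ r` are then squeezed to the right value at the gap
(`envelope_bmAct_eq`).

Uniformities. If `g` and `h` put each point of a finite saturated set `σ` in the same position
relative to a finite `F ⊆ X`, homogeneity yields `h = a * g * b` with `a` fixing `F` and `b` fixing
`σ` (`mem_doubleEntourage_of_forall`). Hence `R_Σ` is induced from the power of `b_m X` over all of
`b_m X`, and the Roelcke uniformity from the power over `X`. The completions are the closures
already described; compactness gives Roelcke precompactness.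

Comparison. Envelope maps act on Roelcke maps by composition, faithfully because constants off `X`
are Roelcke maps; this identifies the two enveloping semigroups. Restriction to `X` gives the
comparison map onto `b_r G`, which is injective when there are no proper gaps. -/

/-! ### Order-theoretic consequences of ultrahomogeneity. -/

section Homogeneity

variable {X : Type*} [LinearOrder X]

theorem IsUltrahomogeneous.exists_apply_eq (hX : IsUltrahomogeneous X) (x y : X) :
    ∃ g : X ≃o X, g x = y := by
  obtain ⟨g, hg⟩ := hX 1 (fun _ => x) (fun _ => y) (Subsingleton.strictMono _)
    (Subsingleton.strictMono _)
  exact ⟨g, hg 0⟩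

theorem IsUltrahomogeneous.noMaxOrder [Infinite X] (hX : IsUltrahomogeneous X) :
    NoMaxOrder X := by
  refine ⟨fun a => ?_⟩
  obtain ⟨b, c, hbc⟩ := exists_pair_lt X
  obtain ⟨g, hg⟩ := hX.exists_apply_eq b a
  exact ⟨g c, hg ▸ g.lt_iff_lt.2 hbc⟩

theorem IsUltrahomogeneous.noMinOrder [Infinite X] (hX : IsUltrahomogeneous X) :
    NoMinOrder X := by
  refine ⟨fun a => ?_⟩
  obtain ⟨b, c, hbc⟩ := exists_pair_lt X
  obtain ⟨g, hg⟩ := hX.exists_apply_eq c a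
  exact ⟨g b, hg ▸ g.lt_iff_lt.2 hbc⟩

theorem IsUltrahomogeneous.exists_orderIso_of_strictMonoOn (hX : IsUltrahomogeneous X)
    (S : Finset X) {y : X → X} (hy : StrictMonoOn y S) :
    ∃ g : X ≃o X, ∀ x ∈ S, g x = y x := by
  have hmem : ∀ k, S.orderEmbOfFin rfl k ∈ S := fun k => S.orderEmbOfFin_mem rfl k
  obtain ⟨g, hg⟩ := hX S.card (S.orderEmbOfFin rfl) (fun k => y (S.orderEmbOfFin rfl k))
    (S.orderEmbOfFin rfl).strictMono
    (fun i j hij => hy (hmem i) (hmem j) ((S.orderEmbOfFin rfl).strictMono hij))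
  refine ⟨g, fun x hx => ?_⟩
  have : x ∈ range (S.orderEmbOfFin rfl) := by
    rw [Finset.range_orderEmbOfFin]; exact hx
  obtain ⟨k, rfl⟩ := this
  exact hg k

/-- For `a < b < c`, an automorphism fixing `a` and moving `c` to `b` carries `b` strictly between
`a` and `b`. -/
theorem IsUltrahomogeneous.denselyOrdered [Infinite X] (hX : IsUltrahomogeneous X) :
    DenselyOrdered X := by
  have := hX.noMaxOrder
  refine ⟨fun a b hab => ?_⟩
  obtain ⟨c, hc⟩ := exists_gt b
  obtain ⟨g, hg⟩ := hX 2 ![a, c] ![a, b]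
    (by simpa [Fin.strictMono_iff_lt_succ] using hab.trans hc)
    (by simpa [Fin.strictMono_iff_lt_succ] using hab)
  have h0 : g a = a := hg 0
  have h1 : g c = b := hg 1
  exact ⟨g b, by simpa [h0] using g.lt_iff_lt.2 hab, by simpa [h1] using g.lt_iff_lt.2 hc⟩

end Homogeneity

/-! ### The order of `b_m X` and its approximation by points of `X`. -/

namespace BMax

variable {X : Type*} [LinearOrder X]

theorem pt_lt_pt {x y : X} {i j : SignType} : pt x i < pt y j ↔ x < y ∨ x = y ∧ i < j := by
  simp [pt, Prod.Lex.toLex_lt_toLex]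

theorem pt_le_pt {x y : X} {i j : SignType} : pt x i ≤ pt y j ↔ x < y ∨ x = y ∧ i ≤ j := by
  simp [pt, Prod.Lex.toLex_le_toLex]

theorem pt_inj {x y : X} {i j : SignType} : pt x i = pt y j ↔ x = y ∧ i = j := by
  simp [pt]

theorem pt_zero_lt_pt_zero {x y : X} : pt x 0 < pt y 0 ↔ x < y := by
  simp [pt_lt_pt]

theorem pt_lt_pt_of_lt {x y : X} (h : x < y) (i j : SignType) : pt x i < pt y j :=
  pt_lt_pt.2 (Or.inl h)

theorem pt_mem_base {x : X} {j : SignType} : pt x j ∈ (base : Set (BMax X)) ↔ j = 0 := by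
  constructor
  · rintro ⟨y, hy⟩
    exact (pt_inj.1 hy).2.symm
  · rintro rfl
    exact ⟨x, rfl⟩

theorem exists_pt_of_lt {p q : BMax X} (h : p < q) : ∃ x j, p < pt x j ∧ pt x j ≤ q := by
  obtain ⟨c, hc⟩ := DedekindCut.lt_iff_exists.1 h
  exact ⟨(ofLex c).1, (ofLex c).2, hc⟩

theorem exists_pt_of_lt' {p q : BMax X} (h : p < q) : ∃ x j, p ≤ pt x j ∧ pt x j < q := by
  obtain ⟨c, hc⟩ := DedekindCut.lt_iff_exists'.1 h
  exact ⟨(ofLex c).1, (ofLex c).2, hc⟩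

theorem pt_zero_lt_iff {x : X} {q : BMax X} : pt x 0 < q ↔ pt x 1 ≤ q := by
  refine ⟨fun h => ?_, fun h => (pt_lt_pt.2 (Or.inr ⟨rfl, by decide⟩)).trans_le h⟩
  obtain ⟨y, j, h₁, h₂⟩ := exists_pt_of_lt h
  refine le_trans (pt_le_pt.2 ?_) h₂
  rcases pt_lt_pt.1 h₁ with h | ⟨h, hj⟩
  · exact Or.inl h
  · have key : ∀ j : SignType, 0 < j → 1 ≤ j := by decide
    exact Or.inr ⟨h, key j hj⟩

theorem lt_pt_zero_iff {x : X} {q : BMax X} : q < pt x 0 ↔ q ≤ pt x (-1) := by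
  refine ⟨fun h => ?_, fun h => h.trans_lt (pt_lt_pt.2 (Or.inr ⟨rfl, by decide⟩))⟩
  obtain ⟨y, j, h₁, h₂⟩ := exists_pt_of_lt' h
  refine le_trans h₁ (pt_le_pt.2 ?_)
  rcases pt_lt_pt.1 h₂ with h | ⟨h, hj⟩
  · exact Or.inl h
  · have key : ∀ j : SignType, j < 0 → j ≤ -1 := by decide
    exact Or.inr ⟨h, key j hj⟩

theorem ne_pt_of_notMem_base {q : BMax X} (hq : q ∉ base) (x : X) : q ≠ pt x 0 :=
  fun h => hq ⟨x, h.symm⟩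

/-- The second inequality cannot be strict in general: between `(z, -1)` and `(z, 0)` there is
nothing. -/
theorem exists_lt_pt_le [DenselyOrdered X] {q b : BMax X} (hq : q ∉ base) (h : q < b) :
    ∃ z : X, q < pt z 0 ∧ pt z 0 ≤ b := by
  obtain ⟨y, j, h₁, h₂⟩ := exists_pt_of_lt h
  rcases lt_trichotomy (pt y 0) q with h₃ | h₃ | h₃
  · exact absurd (pt_zero_lt_iff.1 h₃) (not_le.2 (h₁.trans_le (pt_le_pt.2 (Or.inr ⟨rfl, SignType.le_one j⟩))))
  · exact absurd h₃.symm (ne_pt_of_notMem_base hq y)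
  rcases le_or_gt (pt y 0) b with h₄ | h₄
  · exact ⟨y, h₃, h₄⟩
  obtain ⟨s, i, h₅, h₆⟩ := exists_pt_of_lt' h
  have h₇ : pt s i < pt y (-1) := h₆.trans_le (lt_pt_zero_iff.1 h₄)
  have hsy : s < y := by
    rcases pt_lt_pt.1 h₇ with h | ⟨-, hi⟩
    · exact h
    · exact absurd hi (not_lt.2 (SignType.neg_one_le i))
  obtain ⟨z, hz, hz'⟩ := exists_between hsy
  refine ⟨z, h₅.trans_lt (pt_lt_pt_of_lt hz _ _), (pt_lt_pt_of_lt hz' _ j).le.trans h₂⟩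

theorem exists_le_pt_lt [DenselyOrdered X] {q b : BMax X} (hq : q ∉ base) (h : b < q) :
    ∃ z : X, b ≤ pt z 0 ∧ pt z 0 < q := by
  obtain ⟨y, j, h₁, h₂⟩ := exists_pt_of_lt' h
  rcases lt_trichotomy (pt y 0) q with h₃ | h₃ | h₃
  · rcases le_or_gt b (pt y 0) with h₄ | h₄
    · exact ⟨y, h₄, h₃⟩
    obtain ⟨s, i, h₅, h₆⟩ := exists_pt_of_lt h
    have h₇ : pt y 1 < pt s i := (pt_zero_lt_iff.1 h₄).trans_lt h₅
    have hsy : y < s := by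
      rcases pt_lt_pt.1 h₇ with h | ⟨-, hi⟩
      · exact h
      · exact absurd hi (not_lt.2 (SignType.le_one i))
    obtain ⟨z, hz, hz'⟩ := exists_between hsy
    exact ⟨z, h₁.trans (pt_lt_pt_of_lt hz _ _).le, (pt_lt_pt_of_lt hz' _ i).trans_le h₆⟩
  · exact absurd h₃.symm (ne_pt_of_notMem_base hq y)
  · exact absurd (lt_pt_zero_iff.1 h₃)
      (not_le.2 (lt_of_le_of_lt (pt_le_pt.2 (Or.inr ⟨rfl, SignType.neg_one_le j⟩)) h₂))

variable (X) in
/-- The points of the form `(x, j)`; the other points of `b_m X` are the gaps. -/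
def triplePoints : Set (BMax X) := range fun t : X × SignType => pt t.1 t.2

theorem pt_mem_triplePoints (x : X) (j : SignType) : pt x j ∈ triplePoints X := ⟨(x, j), rfl⟩

theorem base_subset_triplePoints : base ⊆ triplePoints X := by
  rintro _ ⟨x, rfl⟩
  exact pt_mem_triplePoints x 0

/-- Off `X`, only the points `(y, -1)` have an immediate successor. Once they are excluded, a second
application of the weak version, below `(z, -1)`, gives strictness. -/
theorem exists_lt_pt_lt [DenselyOrdered X] {q b : BMax X} (hq : q ∉ base)
    (hq' : ∀ y, q ≠ pt y (-1)) (h : q < b) : ∃ z : X, q < pt z 0 ∧ pt z 0 < b := by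
  obtain ⟨z, hz, hzb⟩ := exists_lt_pt_le hq h
  obtain ⟨w, hw, hwz⟩ := exists_lt_pt_le hq (lt_of_le_of_ne (lt_pt_zero_iff.1 hz) (hq' z))
  exact ⟨w, hw, (lt_pt_zero_iff.2 hwz).trans_le hzb⟩

theorem exists_lt_pt_lt' [DenselyOrdered X] {q b : BMax X} (hq : q ∉ base)
    (hq' : ∀ y, q ≠ pt y 1) (h : b < q) : ∃ z : X, b < pt z 0 ∧ pt z 0 < q := by
  obtain ⟨z, hz, hzb⟩ := exists_le_pt_lt hq h
  obtain ⟨w, hw, hwz⟩ := exists_le_pt_lt hq (lt_of_le_of_ne (pt_zero_lt_iff.1 hzb) (hq' z).symm)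
  exact ⟨w, hz.trans_lt (pt_zero_lt_iff.2 hw), hwz⟩

theorem notMem_base_of_notMem_triplePoints {q : BMax X} (hq : q ∉ triplePoints X) : q ∉ base :=
  fun h => hq (base_subset_triplePoints h)

theorem ne_pt_of_notMem_triplePoints {q : BMax X} (hq : q ∉ triplePoints X) (j : SignType)
    (y : X) : q ≠ pt y j :=
  fun h => hq (h ▸ pt_mem_triplePoints y j)

theorem pt_ne_bot [NoMinOrder X] (x : X) (j : SignType) : pt x j ≠ ⊥ := by
  obtain ⟨y, hy⟩ := exists_lt x
  exact ((bot_le).trans_lt (pt_lt_pt_of_lt hy j j)).ne'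

theorem pt_ne_top [NoMaxOrder X] (x : X) (j : SignType) : pt x j ≠ ⊤ := by
  obtain ⟨y, hy⟩ := exists_gt x
  exact ((pt_lt_pt_of_lt hy j j).trans_le le_top).ne

/-! ### The action -/

theorem smul_le_smul_iff (g : X ≃o X) {p q : BMax X} : g • p ≤ g • q ↔ p ≤ q := by
  rw [← Concept.extent_subset_extent_iff, ← Concept.extent_subset_extent_iff]
  exact image_subset_image_iff (lexAut g).injective

theorem smul_lt_smul_iff (g : X ≃o X) {p q : BMax X} : g • p < g • q ↔ p < q :=
  lt_iff_lt_of_le_iff_le (smul_le_smul_iff g)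

theorem smul_mem_base_iff (g : X ≃o X) {p : BMax X} : g • p ∈ base ↔ p ∈ base := by
  constructor
  · rintro ⟨x, hx⟩
    refine ⟨g⁻¹ x, ?_⟩
    have := congrArg (g⁻¹ • ·) hx
    simpa [smul_pt] using this
  · rintro ⟨x, rfl⟩
    exact ⟨g x, (smul_pt g x 0).symm⟩

theorem smul_bot (g : X ≃o X) : g • (⊥ : BMax X) = ⊥ := by
  refine le_bot_iff.1 ?_
  have := (smul_le_smul_iff g (p := ⊥) (q := g⁻¹ • ⊥)).2 bot_le
  simpa using this

theorem smul_top (g : X ≃o X) : g • (⊤ : BMax X) = ⊤ := by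
  refine top_le_iff.1 ?_
  have := (smul_le_smul_iff g (p := g⁻¹ • ⊤) (q := ⊤)).2 le_top
  simpa using this

end BMax

namespace BMax

variable {X : Type*} [LinearOrder X]

/-! ### The topology -/

theorem isOpen_singleton_pt (x : X) : IsOpen {pt x 0} := by
  have : ({pt x 0} : Set (BMax X)) = Ioo (pt x (-1)) (pt x 1) := by
    ext q
    constructor
    · rintro rfl
      exact ⟨pt_lt_pt.2 (Or.inr ⟨rfl, by decide⟩), pt_lt_pt.2 (Or.inr ⟨rfl, by decide⟩)⟩
    · rintro ⟨h₁, h₂⟩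
      refine le_antisymm ?_ ?_
      · by_contra! h
        exact absurd (pt_zero_lt_iff.1 h) h₂.not_ge
      · by_contra! h
        exact absurd (lt_pt_zero_iff.1 h) h₁.not_ge
  rw [this]
  exact isOpen_Ioo

theorem isOpen_base : IsOpen (base : Set (BMax X)) := by
  have : (base : Set (BMax X)) = ⋃ x, {pt x 0} := by
    ext q; simp [base, eq_comm]
  rw [this]
  exact isOpen_iUnion isOpen_singleton_pt

theorem isClopen_Iio_pt (x : X) : IsClopen (Iio (pt x 0)) := by
  refine ⟨?_, isOpen_Iio⟩
  have : Iio (pt x 0) = Iic (pt x (-1)) := by ext q; exact lt_pt_zero_iff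
  rw [this]
  exact isClosed_Iic

theorem isClopen_Ioi_pt (x : X) : IsClopen (Ioi (pt x 0)) := by
  refine ⟨?_, isOpen_Ioi⟩
  have : Ioi (pt x 0) = Ici (pt x 1) := by ext q; exact pt_zero_lt_iff
  rw [this]
  exact isClosed_Ici

theorem eventually_eq_of_tendsto {ι : Type*} {l : Filter ι} {u : ι → BMax X} {y : X}
    (h : Filter.Tendsto u l (𝓝 (pt y 0))) : ∀ᶠ i in l, u i = pt y 0 :=
  h.eventually ((isOpen_singleton_pt y).mem_nhds rfl)

/-- A bound on the limit can be replaced by some `(z, 0)`; for `z ≠ u i`, the order between `(z, 0)`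
and `(u i, j)` does not depend on `j`. -/
theorem tendsto_pt_of_tendsto [DenselyOrdered X] {ι : Type*} {l : Filter ι} {u : ι → X}
    {q : BMax X} (hq : q ∉ base) (h : Filter.Tendsto (fun i => pt (u i) 0) l (𝓝 q))
    (j : SignType) : Filter.Tendsto (fun i => pt (u i) j) l (𝓝 q) := by
  refine tendsto_order.2 ⟨fun a ha => ?_, fun b hb => ?_⟩
  · obtain ⟨z, hz, hzq⟩ := exists_le_pt_lt hq ha
    filter_upwards [h.eventually (isOpen_Ioi.mem_nhds hzq)] with i hi
    exact hz.trans_lt (pt_lt_pt_of_lt (pt_zero_lt_pt_zero.1 hi) _ _)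
  · obtain ⟨z, hz, hzq⟩ := exists_lt_pt_le hq hb
    filter_upwards [h.eventually (isOpen_Iio.mem_nhds hz)] with i hi
    exact (pt_lt_pt_of_lt (pt_zero_lt_pt_zero.1 hi) _ _).trans_le hzq

/-- A point off `X` is approached by `X` from above unless it is `⊤` or some `(y, -1)`, and from
below unless it is `⊥` or some `(y, 1)`. -/
theorem exists_pt_mem_of_mem_nhds [DenselyOrdered X] [NoMinOrder X] [NoMaxOrder X] [Nonempty X]
    {q : BMax X} {U : Set (BMax X)} (hU : U ∈ 𝓝 q) : ∃ x, pt x 0 ∈ U := by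
  by_cases hq : q ∈ base
  · obtain ⟨x, rfl⟩ := hq
    exact ⟨x, mem_of_mem_nhds hU⟩
  have above : ∀ b, q < b → (∀ y, q ≠ pt y (-1)) → ∃ x, pt x 0 ∈ U := fun b hb hy => by
    obtain ⟨u, hu, hsub⟩ := exists_Ico_subset_of_mem_nhds hU ⟨b, hb⟩
    obtain ⟨z, hz, hzu⟩ := exists_lt_pt_lt hq hy hu
    exact ⟨z, hsub ⟨hz.le, hzu⟩⟩
  by_cases hb : q = ⊥
  · obtain ⟨x⟩ := ‹Nonempty X›
    exact above (pt x 0) (hb ▸ bot_lt_iff_ne_bot.2 (pt_ne_bot x 0))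
      fun y h => pt_ne_bot y _ (h.symm.trans hb)
  by_cases h1 : ∃ y, q = pt y 1
  · obtain ⟨y, rfl⟩ := h1
    exact above ⊤ (lt_top_iff_ne_top.2 (pt_ne_top y 1)) fun z h =>
      absurd (pt_inj.1 h).2 (by decide)
  · push Not at h1
    obtain ⟨l, hl, hsub⟩ := exists_Ioc_subset_of_mem_nhds hU ⟨⊥, bot_lt_iff_ne_bot.2 hb⟩
    obtain ⟨z, hz, hzu⟩ := exists_lt_pt_lt' hq h1 hl
    exact ⟨z, hsub ⟨hz, hzu.le⟩⟩

/-- The inductive step of the approximation: a value already chosen near `p` must leave room for a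
larger one near `q`. For `p < q` separated neighbourhoods suffice; for `p = q` it is essential that
this point is not isolated. -/
theorem exists_nhds_forall_exists_gt [DenselyOrdered X] [NoMinOrder X] [NoMaxOrder X] [Nonempty X]
    {p q : BMax X} (hpq : p ≤ q) (hq : p = q → q ∉ base) {U : Set (BMax X)} (hU : U ∈ 𝓝 q) :
    ∃ W ∈ 𝓝 p, ∀ t, pt t 0 ∈ W → ∃ t' > t, pt t' 0 ∈ U := by
  rcases hpq.lt_or_eq with h | rfl
  · obtain ⟨u, v, hu, hv, hpu, hqv, huv⟩ := order_separated h
    obtain ⟨t', ht'⟩ := exists_pt_mem_of_mem_nhds (Filter.inter_mem hU (hv.mem_nhds hqv))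
    exact ⟨u, hu.mem_nhds hpu, fun t ht => ⟨t', pt_zero_lt_pt_zero.1 (huv _ ht _ ht'.2), ht'.1⟩⟩
  have hp := hq rfl
  -- `A` controls `U` below `p` and `B` above it. A larger `t'` taken in `B` stays in the upper set
  -- `A`, so it lies in `U` on whichever side of `p` it falls.
  obtain ⟨A, hA, hAup, hAU⟩ : ∃ A ∈ 𝓝 p, IsUpperSet A ∧ A ∩ Iic p ⊆ U := by
    by_cases hb : p = ⊥
    · refine ⟨univ, Filter.univ_mem, isUpperSet_univ, ?_⟩
      rintro r ⟨-, hr⟩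
      have : r = p := le_antisymm hr (hb ▸ bot_le)
      exact this ▸ mem_of_mem_nhds hU
    · obtain ⟨l, hl, hsub⟩ := exists_Ioc_subset_of_mem_nhds hU ⟨⊥, bot_lt_iff_ne_bot.2 hb⟩
      exact ⟨Ioi l, isOpen_Ioi.mem_nhds hl, isUpperSet_Ioi l, hsub⟩
  obtain ⟨B, hB, hBgt, hBU⟩ : ∃ B ∈ 𝓝 p, (∀ t, pt t 0 ∈ B → ∃ t' > t, pt t' 0 ∈ B) ∧
      B ∩ Ici p ⊆ U := by
    by_cases hb : p = ⊤
    · refine ⟨univ, Filter.univ_mem, fun t _ => (exists_gt t).imp fun t' h => ⟨h, trivial⟩, ?_⟩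
      rintro r ⟨-, hr⟩
      have : r = p := le_antisymm (hb ▸ le_top) hr
      exact this ▸ mem_of_mem_nhds hU
    · obtain ⟨u, hu, hsub⟩ := exists_Ico_subset_of_mem_nhds hU ⟨⊤, lt_top_iff_ne_top.2 hb⟩
      obtain ⟨z, hz, hzu⟩ := exists_lt_pt_le hp hu
      refine ⟨Iio (pt z 0), isOpen_Iio.mem_nhds hz, fun t ht => ?_, fun r hr =>
        hsub ⟨hr.2, (mem_Iio.1 hr.1).trans_le hzu⟩⟩
      obtain ⟨t', h₁, h₂⟩ := exists_between (pt_zero_lt_pt_zero.1 ht)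
      exact ⟨t', h₁, pt_zero_lt_pt_zero.2 h₂⟩
  refine ⟨A ∩ B, Filter.inter_mem hA hB, fun t ht => ?_⟩
  obtain ⟨t', htt', ht'⟩ := hBgt t ht.2
  have htA : pt t' 0 ∈ A := hAup (pt_lt_pt_of_lt htt' 0 0).le ht.1
  rcases le_total (pt t' 0) p with h | h
  · exact ⟨t', htt', hAU ⟨htA, h⟩⟩
  · exact ⟨t', htt', hBU ⟨ht', h⟩⟩

/-! ### Roelcke maps as limits of automorphisms, and continuity of the action. -/

theorem exists_strictMonoOn_approx [DenselyOrdered X] [NoMinOrder X] [NoMaxOrder X] [Nonempty X]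
    {F : X → BMax X} (hF : IsRoelckeMap F) (S : Finset X) :
    ∀ U : X → Set (BMax X), (∀ x ∈ S, U x ∈ 𝓝 (F x)) →
      ∃ y : X → X, StrictMonoOn y S ∧ ∀ x ∈ S, pt (y x) 0 ∈ U x := by
  classical
  induction S using Finset.induction_on_max with
  | empty => exact fun U _ => ⟨id, strictMono_id.strictMonoOn _, by simp⟩
  | insert a S ha ih =>
    intro U hU
    have key : ∃ y : X → X, StrictMonoOn y S ∧ (∀ x ∈ S, pt (y x) 0 ∈ U x) ∧
        ∃ t, pt t 0 ∈ U a ∧ ∀ x ∈ S, y x < t := by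
      rcases S.eq_empty_or_nonempty with rfl | hS
      · obtain ⟨t, ht⟩ := exists_pt_mem_of_mem_nhds (hU a (by simp))
        exact ⟨id, strictMono_id.strictMonoOn _, by simp, t, ht, by simp⟩
      · have hm := S.max'_mem hS
        set m := S.max' hS with hmdef
        obtain ⟨W, hW, hWU⟩ := exists_nhds_forall_exists_gt (hF.monotone m a (ha m hm))
          (fun h => h ▸ hF.eq_imp m a (ha m hm).ne h) (hU a (by simp))
        -- The neighbourhood at the previous maximum `m` is shrunk to `W` in advance, so that a
        -- value for `a` above `y m` exists; this is why the induction quantifies over `U`.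
        obtain ⟨y, hy, hyU⟩ := ih (fun x => U x ∩ {p | x = m → p ∈ W}) (fun x hx => by
          refine Filter.inter_mem (hU x (by simp [hx])) ?_
          by_cases hxm : x = m
          · subst hxm
            exact Filter.mem_of_superset hW fun p hp _ => hp
          · exact Filter.univ_mem' fun p h => absurd h hxm)
        obtain ⟨t, htm, ht⟩ := hWU (y m) ((hyU m hm).2 rfl)
        refine ⟨y, hy, fun x hx => (hyU x hx).1, t, ht, fun x hx => ?_⟩
        exact (hy.monotoneOn hx hm (S.le_max' x hx)).trans_lt htm
    obtain ⟨y, hy, hyU, t, ht, hyt⟩ := key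
    have haS : ∀ x ∈ S, x ≠ a := fun x hx => (ha x hx).ne
    refine ⟨Function.update y a t, ?_, ?_⟩
    · intro x hx x' hx' hxx'
      simp only [Finset.coe_insert, mem_insert_iff, Finset.mem_coe] at hx hx'
      rcases hx with rfl | hx <;> rcases hx' with rfl | hx'
      · exact absurd hxx' (lt_irrefl _)
      · exact absurd hxx' (ha x' hx').not_gt
      · simpa [haS x hx] using hyt x hx
      · simpa [haS x hx, haS x' hx'] using hy hx hx' hxx'
    · intro x hx
      rcases Finset.mem_insert.1 hx with rfl | hx
      · simpa using ht
      · simpa [haS x hx] using hyU x hx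

/-- The map `X → b_m X`, `x ↦ (g x, 0)`, given by an automorphism `g`. -/
def ofAut (g : X ≃o X) : X → BMax X := fun x => pt (g x) 0

/-- Taking the common value `(z, 0)` at two given arguments is an open condition, since `(z, 0)` is
isolated; excluding it is closed. -/
theorem isClosed_setOf_isRoelckeMap : IsClosed {f : X → BMax X | IsRoelckeMap f} := by
  have : {f : X → BMax X | IsRoelckeMap f} =
      (⋂ x, ⋂ y, ⋂ _ : x < y, {f | f x ≤ f y}) ∩
        ⋂ x, ⋂ y, ⋂ _ : x ≠ y, ⋂ z, {f | ¬ (f x = pt z 0 ∧ f y = pt z 0)} := by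
    ext f
    simp only [mem_ofPred_eq, mem_inter_iff, mem_iInter]
    constructor
    · rintro ⟨h₁, h₂⟩
      exact ⟨h₁, fun x y hxy z hz => h₂ x y hxy (hz.1.trans hz.2.symm) ⟨z, hz.1.symm⟩⟩
    · rintro ⟨h₁, h₂⟩
      refine ⟨h₁, fun x y hxy h => ?_⟩
      rintro ⟨z, hz⟩
      exact h₂ x y hxy z ⟨hz.symm, h.symm.trans hz.symm⟩
  rw [this]
  refine IsClosed.inter ?_ ?_
  · exact isClosed_iInter fun x => isClosed_iInter fun y => isClosed_iInter fun _ =>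
      isClosed_le (continuous_apply x) (continuous_apply y)
  · refine isClosed_iInter fun x => isClosed_iInter fun y => isClosed_iInter fun _ =>
      isClosed_iInter fun z => isOpen_compl_iff.1 ?_
    have : {f : X → BMax X | ¬ (f x = pt z 0 ∧ f y = pt z 0)}ᶜ =
        (fun f => f x) ⁻¹' {pt z 0} ∩ (fun f => f y) ⁻¹' {pt z 0} := by
      ext f; simp
    rw [this]
    exact ((isOpen_singleton_pt z).preimage (continuous_apply x)).inter
      ((isOpen_singleton_pt z).preimage (continuous_apply y))

theorem isRoelckeMap_ofAut (g : X ≃o X) : IsRoelckeMap (ofAut g) where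
  monotone _ _ h := (pt_lt_pt_of_lt (g.lt_iff_lt.2 h) 0 0).le
  eq_imp _ _ h h' := absurd (g.injective (pt_inj.1 h').1) h

theorem closure_range_ofAut [Infinite X] (hX : IsUltrahomogeneous X) :
    closure (range (ofAut (X := X))) = {f | IsRoelckeMap f} := by
  have := hX.noMinOrder
  have := hX.noMaxOrder
  have := hX.denselyOrdered
  refine subset_antisymm (closure_minimal ?_ isClosed_setOf_isRoelckeMap) fun F hF => ?_
  · rintro _ ⟨g, rfl⟩
    exact isRoelckeMap_ofAut g
  · refine mem_closure_iff.2 fun o ho hFo => ?_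
    obtain ⟨S, u, hu, hsub⟩ := isOpen_pi_iff.1 ho F hFo
    obtain ⟨y, hy, hyu⟩ := exists_strictMonoOn_approx hF S u
      fun x hx => (hu x hx).1.mem_nhds (hu x hx).2
    obtain ⟨g, hg⟩ := hX.exists_orderIso_of_strictMonoOn S hy
    refine ⟨ofAut g, hsub fun x hx => ?_, g, rfl⟩
    simpa only [ofAut, hg x hx] using hyu x hx

theorem exists_filter_tendsto [Infinite X] (hX : IsUltrahomogeneous X) {F : X → BMax X}
    (hF : IsRoelckeMap F) :
    ∃ l : Filter (X ≃o X), l.NeBot ∧ ∀ x, Filter.Tendsto (fun g => pt (g x) 0) l (𝓝 (F x)) := by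
  have : F ∈ closure (range (ofAut (X := X))) := by rw [closure_range_ofAut hX]; exact hF
  refine ⟨Filter.comap ofAut (𝓝 F), Filter.comap_neBot_iff.2 fun s hs => ?_,
    tendsto_pi_nhds.1 Filter.tendsto_comap⟩
  obtain ⟨_, hs', g, rfl⟩ := mem_closure_iff_nhds.1 this s hs
  exact ⟨g, hs'⟩

/-- Off `X`, bounds on `g • p` can be taken of the form `(z, 0)`. Every `h` near `g` agrees with `g`
at `g⁻¹ z`, so it carries a bound on points near `p` to the same bound `(z, 0)`. -/
instance [DenselyOrdered X] : ContinuousSMul (X ≃o X) (BMax X) where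
  continuous_smul := by
    refine continuous_iff_continuousAt.2 fun ⟨g, p⟩ => ?_
    have hev : ∀ x : X, ∀ᶠ h : (X ≃o X) × BMax X in 𝓝 (g, p), h.1 x = g x := fun x =>
      (continuous_fst.tendsto (g, p)).eventually ((isOpen_setOf_apply_eq x (g x)).mem_nhds rfl)
    by_cases hp : p ∈ base
    · obtain ⟨x, rfl⟩ := hp
      refine tendsto_nhds_of_eventually_eq ?_
      filter_upwards [hev x, (continuous_snd.tendsto _).eventually
        ((isOpen_singleton_pt x).mem_nhds rfl)] with h h₁ h₂
      have h₂ : h.2 = pt x 0 := h₂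
      simp only [h₂, smul_pt, h₁]
    have hgp : g • p ∉ base := fun h => hp ((smul_mem_base_iff g).1 h)
    have hz : ∀ z : X, ∀ᶠ h : (X ≃o X) × BMax X in 𝓝 (g, p), h.1 • pt (g⁻¹ z) 0 = pt z 0 :=
      fun z => (hev (g⁻¹ z)).mono fun h hh => by simp [smul_pt, hh]
    have hz' : ∀ z : X, g • pt (g⁻¹ z) 0 = pt z 0 := fun z => by simp [smul_pt]
    refine tendsto_order.2 ⟨fun a ha => ?_, fun b hb => ?_⟩
    · obtain ⟨z, hza, hzg⟩ := exists_le_pt_lt hgp ha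
      rw [← hz' z] at hzg
      filter_upwards [hz z, (continuous_snd.tendsto _).eventually
        (isOpen_Ioi.mem_nhds ((smul_lt_smul_iff g).1 hzg))] with h h₁ h₂
      exact hza.trans_lt (h₁ ▸ (smul_lt_smul_iff h.1).2 h₂)
    · obtain ⟨z, hzg, hzb⟩ := exists_lt_pt_le hgp hb
      rw [← hz' z] at hzg
      filter_upwards [hz z, (continuous_snd.tendsto _).eventually
        (isOpen_Iio.mem_nhds ((smul_lt_smul_iff g).1 hzg))] with h h₁ h₂
      exact (h₁ ▸ (smul_lt_smul_iff h.1).2 h₂ : h.1 • h.2 < pt z 0).trans_le hzb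

end BMax

/-! ### Generalities on envelopes, and algebra of the explicit conditions. -/

section Envelope

variable {G K : Type*} [TopologicalSpace K] (ρ : G → K → K)

theorem denseRange_toEnvelope : DenseRange (toEnvelope ρ) := by
  intro f
  rw [closure_subtype, ← range_comp]
  exact f.2

instance [CompactSpace K] : CompactSpace (envelope ρ) :=
  isCompact_iff_compactSpace.1 isClosed_closure.isCompact

end Envelope

/-- The permutation topology is generated by the conditions `g x = y`, so it is enough to recover
each value `g x` from a neighbourhood of `i g`. -/
theorem isInducing_of_forall_eventually {X K : Type*} [LinearOrder X] [TopologicalSpace K]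
    {i : (X ≃o X) → K} (hi : Continuous i)
    (h : ∀ (x : X) (g : X ≃o X), ∀ᶠ k in 𝓝 (i g), ∀ g', i g' = k → g' x = g x) :
    IsInducing i := by
  refine ⟨le_antisymm hi.le_induced (continuous_id_iff_le.1 ?_)⟩
  refine @continuous_to_aut X _ (X ≃o X) (TopologicalSpace.induced i _) id fun x t => ?_
  rw [nhds_induced]
  exact Filter.eventually_comap.2 (h x t)

theorem IsEnvelopeMap.id {X : Type*} [LinearOrder X] : IsEnvelopeMap X id where
  monotone _ _ h := h.le
  map_compl _ h := h
  eq_imp _ _ h h' := absurd h' h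
  triples x := Or.inr ⟨x, rfl, rfl, rfl⟩
  map_bot := rfl
  map_top := rfl

theorem IsEnvelopeMap.monotone' {X : Type*} [LinearOrder X] {f : BMax X → BMax X}
    (hf : IsEnvelopeMap X f) : Monotone f := fun p q h =>
  h.lt_or_eq.elim (hf.monotone p q) fun h => h ▸ le_rfl

theorem IsEnvelopeMap.comp {X : Type*} [LinearOrder X] {f h : BMax X → BMax X}
    (hf : IsEnvelopeMap X f) (hh : IsEnvelopeMap X h) : IsEnvelopeMap X (f ∘ h) where
  monotone p q hpq := hf.monotone' (hh.monotone p q hpq)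
  map_compl p hp := hf.map_compl _ (hh.map_compl p hp)
  eq_imp p q hpq e := by
    by_cases h' : h p = h q
    · exact hf.map_compl _ (hh.eq_imp p q hpq h')
    · exact hf.eq_imp _ _ h' e
  triples x := by
    rcases hh.triples x with ⟨h₁, h₂, h₃⟩ | ⟨y, h₁, h₂, h₃⟩
    · exact Or.inl ⟨congrArg f h₁, congrArg f h₂, hf.map_compl _ h₃⟩
    · simpa only [Function.comp_apply, h₁, h₂, h₃] using hf.triples y
  map_bot := (congrArg f hh.map_bot).trans hf.map_bot
  map_top := (congrArg f hh.map_top).trans hf.map_top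

theorem IsEnvelopeMap.comp_isRoelckeMap {X : Type*} [LinearOrder X] {f : BMax X → BMax X}
    (hf : IsEnvelopeMap X f) {r : X → BMax X} (hr : IsRoelckeMap r) : IsRoelckeMap (f ∘ r) where
  monotone x y hxy := hf.monotone' (hr.monotone x y hxy)
  eq_imp x y hxy e := by
    by_cases h' : r x = r y
    · exact hf.map_compl _ (hr.eq_imp x y hxy h')
    · exact hf.eq_imp _ _ h' e

/-! ### The envelope of the action on `b_m X`. -/

namespace BMax

variable {X : Type*} [LinearOrder X]

/-- For a triple there are two cases: if the limit of `(g x, 0)` is isolated, `g x` is eventually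
constant and the whole triple follows; otherwise the triple is squeezed to that limit. -/
theorem isEnvelopeMap_of_tendsto [DenselyOrdered X] {f : BMax X → BMax X} {l : Filter (X ≃o X)}
    [l.NeBot] (h : ∀ p, Filter.Tendsto (fun g : X ≃o X => g • p) l (𝓝 (f p))) :
    IsEnvelopeMap X f where
  monotone p q hpq := le_of_tendsto_of_tendsto' (h p) (h q) fun g =>
    (smul_le_smul_iff g).2 hpq.le
  map_compl p hp := isOpen_base.isClosed_compl.mem_of_tendsto (h p)
    (Filter.Eventually.of_forall fun g hg => hp ((smul_mem_base_iff g).1 hg))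
  eq_imp p q hpq e := by
    rintro ⟨z, hz⟩
    have h₁ := h p
    have h₂ := h q
    rw [← e] at h₂
    rw [← hz] at h₁ h₂
    obtain ⟨g, hg₁, hg₂⟩ :=
      ((eventually_eq_of_tendsto h₁).and (eventually_eq_of_tendsto h₂)).exists
    exact hpq (MulAction.injective g (hg₁.trans hg₂.symm))
  triples x := by
    have hj : ∀ j, Filter.Tendsto (fun g : X ≃o X => pt (g x) j) l (𝓝 (f (pt x j))) := fun j => by
      simpa only [smul_pt] using h (pt x j)
    by_cases hx : f (pt x 0) ∈ base
    · obtain ⟨y, hy⟩ := hx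
      have hy : pt y 0 = f (pt x 0) := hy
      have hev := eventually_eq_of_tendsto (hy ▸ hj 0)
      have hj' : ∀ j, f (pt x j) = pt y j := fun j =>
        tendsto_nhds_unique (hj j) (tendsto_nhds_of_eventually_eq
          (hev.mono fun g hg => by rw [(pt_inj.1 hg).1]))
      exact Or.inr ⟨y, hj' _, hj' _, hj' _⟩
    · have hj' : ∀ j, f (pt x j) = f (pt x 0) := fun j =>
        tendsto_nhds_unique (hj j) (tendsto_pt_of_tendsto hx (hj 0) j)
      exact Or.inl ⟨hj' _, (hj' _).symm, hx⟩
  map_bot := tendsto_nhds_unique (h ⊥) (by simp only [smul_bot]; exact tendsto_const_nhds)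
  map_top := tendsto_nhds_unique (h ⊤) (by simp only [smul_top]; exact tendsto_const_nhds)

/-- The point `x` and the element `p` of `b_m X` lie in the same way with respect to the points
of `S`. -/
def SameCell (S : Set X) (p : BMax X) (x : X) : Prop :=
  ∀ s ∈ S, (pt s 0 < p ↔ s < x) ∧ (p < pt s 0 ↔ x < s)

theorem eventually_sameCell {S : Set X} (hS : S.Finite) {p : BMax X} (hp : p ∉ base) :
    ∀ᶠ q in 𝓝 p, ∀ x, q = pt x 0 → SameCell S p x := by
  have : ∀ᶠ q in 𝓝 p, ∀ s ∈ S, (pt s 0 < p → pt s 0 < q) ∧ (p < pt s 0 → q < pt s 0) := by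
    refine (Filter.eventually_all_finite hS).2 fun s _ => ?_
    rcases lt_or_gt_of_ne (ne_pt_of_notMem_base hp s) with h | h
    · filter_upwards [isOpen_Iio.mem_nhds h] with q hq
      exact ⟨fun h' => absurd h' h.not_gt, fun _ => hq⟩
    · filter_upwards [isOpen_Ioi.mem_nhds h] with q hq
      exact ⟨fun _ => hq, fun h' => absurd h' h.not_gt⟩
  filter_upwards [this] with q hq x hx s hs
  subst hx
  obtain ⟨h₁, h₂⟩ := hq s hs
  simp only [pt_zero_lt_pt_zero] at h₁ h₂
  rcases lt_or_gt_of_ne (ne_pt_of_notMem_base hp s) with h | h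
  · exact ⟨⟨h₁, fun h' => absurd h' (h₂ h).not_gt⟩, ⟨h₂, fun _ => h⟩⟩
  · exact ⟨⟨h₁, fun _ => h⟩, ⟨h₂, fun h' => absurd h' (h₁ h).not_gt⟩⟩

/-- Sends every `x` whose cell contains an element of `T` to such an element, and every other
point of `X` to itself. -/
noncomputable def collapse (S : Set X) (T : Set (BMax X)) (x : X) : BMax X :=
  open scoped Classical in
  if h : ∃ p ∈ T, SameCell S p x then h.choose else pt x 0

theorem collapse_spec (S : Set X) (T : Set (BMax X)) (x : X) :
    (collapse S T x ∈ T ∧ SameCell S (collapse S T x) x) ∨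
      (collapse S T x = pt x 0 ∧ ∀ p ∈ T, ¬ SameCell S p x) := by
  unfold collapse
  split_ifs with h
  · exact Or.inl h.choose_spec
  · push Not at h
    exact Or.inr ⟨rfl, h⟩

/-- Cells are convex, and the points of `S` between distinct elements of `T` make their cells
disjoint. So replacing each such cell by its element of `T` preserves the order, and merging happens
only at elements of `T`. -/
theorem isRoelckeMap_collapse {S : Set X} {T : Set (BMax X)} (hT : ∀ p ∈ T, p ∉ base)
    (hST : ∀ p ∈ T, ∀ q ∈ T, p < q → ∃ s ∈ S, p < pt s 0 ∧ pt s 0 < q) :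
    IsRoelckeMap (collapse S T) where
  monotone x y hxy := by
    rcases collapse_spec S T x with ⟨h₁, h₂⟩ | ⟨h₁, h₂⟩ <;>
      rcases collapse_spec S T y with ⟨h₃, h₄⟩ | ⟨h₃, h₄⟩
    · by_contra! h
      obtain ⟨s, hs, hs₁, hs₂⟩ := hST _ h₃ _ h₁ h
      exact lt_asymm hxy (((h₄ s hs).2.1 hs₁).trans ((h₂ s hs).1.1 hs₂))
    · by_contra! h
      rw [h₃] at h
      refine h₄ _ h₁ fun s hs => ⟨⟨fun h' => ((h₂ s hs).1.1 h').trans hxy, fun h' => ?_⟩,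
        ⟨fun h' => pt_zero_lt_pt_zero.1 (h.trans h'), fun h' => (h₂ s hs).2.2 (hxy.trans h')⟩⟩
      exact (pt_zero_lt_pt_zero.2 h').trans h
    · by_contra! h
      rw [h₁] at h
      refine h₂ _ h₃ fun s hs => ⟨⟨fun h' => pt_zero_lt_pt_zero.1 (h'.trans h), fun h' =>
        (h₄ s hs).1.2 (h'.trans hxy)⟩, ⟨fun h' => hxy.trans ((h₄ s hs).2.1 h'), fun h' => ?_⟩⟩
      exact h.trans (pt_zero_lt_pt_zero.2 h')
    · rw [h₁, h₃]
      exact (pt_zero_lt_pt_zero.2 hxy).le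
  eq_imp x y hxy e := by
    rcases collapse_spec S T x with ⟨h₁, -⟩ | ⟨h₁, -⟩
    · exact hT _ h₁
    rcases collapse_spec S T y with ⟨h₃, -⟩ | ⟨h₃, -⟩
    · exact e ▸ hT _ h₃
    · exact absurd (pt_inj.1 (h₁.symm.trans (e.trans h₃))).1 hxy

theorem collapse_eq_pt {S : Set X} {T : Set (BMax X)} (hT : ∀ p ∈ T, p ∉ base) {x : X}
    (hx : x ∈ S) : collapse S T x = pt x 0 := by
  rcases collapse_spec S T x with ⟨h₁, h₂⟩ | ⟨h₁, -⟩
  · rcases lt_or_gt_of_ne (ne_pt_of_notMem_base (hT _ h₁) x) with h | h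
    · exact absurd ((h₂ x hx).2.1 h) (lt_irrefl x)
    · exact absurd ((h₂ x hx).1.1 h) (lt_irrefl x)
  · exact h₁

theorem collapse_eq_of_sameCell {S : Set X} {T : Set (BMax X)}
    (hST : ∀ p ∈ T, ∀ q ∈ T, p < q → ∃ s ∈ S, p < pt s 0 ∧ pt s 0 < q) {p : BMax X} (hp : p ∈ T)
    {x : X} (hx : SameCell S p x) : collapse S T x = p := by
  have key : ∀ q ∈ T, ∀ q' ∈ T, SameCell S q x → SameCell S q' x → q ≤ q' :=
    fun q hq q' hq' h h' => by
      by_contra! hlt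
      obtain ⟨s, hs, hs₁, hs₂⟩ := hST _ hq' _ hq hlt
      exact lt_asymm ((h s hs).1.1 hs₂) ((h' s hs).2.1 hs₁)
  rcases collapse_spec S T x with ⟨h₁, h₂⟩ | ⟨-, h₂⟩
  · exact le_antisymm (key _ h₁ _ hp h₂ hx) (key _ hp _ h₁ hx h₂)
  · exact absurd hx (h₂ p hp)

/-- This lets `f ∘ r` record the values of `f` on `σ`: at triples through the middle point, at gaps
through two flanking points of `X` with the same image. -/
theorem exists_isRoelckeMap_collapsing [DenselyOrdered X] (σ : Finset (BMax X)) :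
    ∃ r : X → BMax X, IsRoelckeMap r ∧ (∀ x j, pt x j ∈ σ → r x = pt x 0) ∧
      ∀ p ∈ σ, p ∉ triplePoints X → p ≠ ⊥ → p ≠ ⊤ →
        ∃ a b, pt a 0 < p ∧ p < pt b 0 ∧ r a = p ∧ r b = p := by
  classical
  rcases isEmpty_or_nonempty X with hX | hX
  · refine ⟨fun x => pt x 0, ⟨fun x => hX.elim x, fun x => hX.elim x⟩, fun x => hX.elim x,
      fun p _ _ h₁ h₂ => ?_⟩
    obtain ⟨x, -⟩ := exists_pt_of_lt (bot_lt_iff_ne_bot.2 h₁)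
    exact hX.elim x
  have hsep : ∀ t : BMax X × BMax X, ∃ z : X, t.1 ∉ triplePoints X → t.1 < t.2 →
      t.1 < pt z 0 ∧ pt z 0 < t.2 := fun t => by
    by_cases h : t.1 ∉ triplePoints X ∧ t.1 < t.2
    · obtain ⟨z, hz⟩ := exists_lt_pt_lt (notMem_base_of_notMem_triplePoints h.1)
        (ne_pt_of_notMem_triplePoints h.1 _) h.2
      exact ⟨z, fun _ _ => hz⟩
    · exact ⟨hX.some, fun h₁ h₂ => absurd ⟨h₁, h₂⟩ h⟩
  choose sep hsep using hsep
  -- The first part of `S` forces `r` to keep the points whose triples meet `σ`; the second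
  -- separates the gaps in `σ` from each other.
  set S : Set X := (⋃ j : SignType, (fun x => pt x j) ⁻¹' (σ : Set (BMax X))) ∪
    sep '' ((σ ×ˢ σ : Finset _) : Set (BMax X × BMax X)) with hS
  have hSfin : S.Finite := by
    refine Set.Finite.union (Set.finite_iUnion fun j => ?_) ((Finset.finite_toSet _).image _)
    exact σ.finite_toSet.preimage fun x _ y _ h => (pt_inj.1 h).1
  set T : Set (BMax X) := {p | p ∈ σ ∧ p ∉ triplePoints X} with hTdef
  have hT : ∀ p ∈ T, p ∉ base := fun p hp => notMem_base_of_notMem_triplePoints hp.2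
  have hST : ∀ p ∈ T, ∀ q ∈ T, p < q → ∃ s ∈ S, p < pt s 0 ∧ pt s 0 < q :=
    fun p hp q hq h => ⟨sep (p, q),
      Or.inr ⟨(p, q), by simpa using ⟨hp.1, hq.1⟩, rfl⟩, hsep (p, q) hp.2 h⟩
  refine ⟨collapse S T, isRoelckeMap_collapse hT hST, fun x j hx =>
    collapse_eq_pt hT (Or.inl (mem_iUnion.2 ⟨j, hx⟩)), fun p hp hpt hbot htop => ?_⟩
  have hb := notMem_base_of_notMem_triplePoints hpt
  have hcell := eventually_sameCell hSfin hb
  obtain ⟨l, hl, hlsub⟩ := exists_Ioc_subset_of_mem_nhds hcell ⟨⊥, bot_lt_iff_ne_bot.2 hbot⟩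
  obtain ⟨u, hu, husub⟩ := exists_Ico_subset_of_mem_nhds hcell ⟨⊤, lt_top_iff_ne_top.2 htop⟩
  obtain ⟨a, hla, hap⟩ := exists_lt_pt_lt' hb (ne_pt_of_notMem_triplePoints hpt _) hl
  obtain ⟨b, hpb, hbu⟩ := exists_lt_pt_lt hb (ne_pt_of_notMem_triplePoints hpt _) hu
  exact ⟨a, b, hap, hpb, collapse_eq_of_sameCell hST ⟨hp, hpt⟩ (hlsub ⟨hla, hap.le⟩ a rfl),
    collapse_eq_of_sameCell hST ⟨hp, hpt⟩ (husub ⟨hpb.le, hbu⟩ b rfl)⟩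

theorem tendsto_pt_of_isEnvelopeMap [DenselyOrdered X] {f : BMax X → BMax X}
    (hf : IsEnvelopeMap X f) {l : Filter (X ≃o X)} {x : X}
    (h : Filter.Tendsto (fun g : X ≃o X => pt (g x) 0) l (𝓝 (f (pt x 0)))) (j : SignType) :
    Filter.Tendsto (fun g : X ≃o X => pt (g x) j) l (𝓝 (f (pt x j))) := by
  rcases hf.triples x with ⟨h₁, h₂, h₃⟩ | ⟨y, h₁, h₂, h₃⟩
  · have : f (pt x j) = f (pt x 0) := by
      -- The constructors of `SignType` come in the order `0`, `-1`, `1`.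
      rcases j with _ | _ | _
      exacts [rfl, h₁, h₂.symm]
    rw [this]
    exact tendsto_pt_of_tendsto h₃ h j
  · have : f (pt x j) = pt y j := by
      rcases j with _ | _ | _
      exacts [h₂, h₁, h₃]
    rw [this]
    rw [h₂] at h
    exact tendsto_nhds_of_eventually_eq
      ((eventually_eq_of_tendsto h).mono fun g hg => by rw [(pt_inj.1 hg).1])

theorem envelope_bmAct_eq [Infinite X] (hX : IsUltrahomogeneous X) :
    envelope (bmAct (X := X)) = {f | IsEnvelopeMap X f} := by
  have := hX.denselyOrdered
  refine subset_antisymm (fun f hf => ?_) fun f hf => ?_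
  · have hne : (Filter.comap (bmAct (X := X)) (𝓝 f)).NeBot :=
      Filter.comap_neBot_iff.2 fun s hs => by
        obtain ⟨_, hs', g, rfl⟩ := mem_closure_iff_nhds.1 hf s hs
        exact ⟨g, hs'⟩
    exact isEnvelopeMap_of_tendsto (tendsto_pi_nhds.1
      (Filter.tendsto_comap (f := bmAct (X := X)) (x := 𝓝 f)))
  · refine mem_closure_iff.2 fun o ho hfo => ?_
    obtain ⟨σ, u, hu, hsub⟩ := isOpen_pi_iff.1 ho f hfo
    obtain ⟨r, hr, hrpt, hrgap⟩ := exists_isRoelckeMap_collapsing σ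
    obtain ⟨l, hl, hlim⟩ := exists_filter_tendsto hX (hf.comp_isRoelckeMap hr)
    have key : ∀ p ∈ σ, Filter.Tendsto (fun g : X ≃o X => g • p) l (𝓝 (f p)) := fun p hp => by
      by_cases hpt : p ∈ triplePoints X
      · obtain ⟨⟨x, j⟩, rfl⟩ := hpt
        have hx := hlim x
        simp only [Function.comp_apply, hrpt x j hp] at hx
        simp only [smul_pt]
        exact tendsto_pt_of_isEnvelopeMap hf hx j
      by_cases hbot : p = ⊥
      · subst hbot
        simp only [smul_bot, hf.map_bot]
        exact tendsto_const_nhds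
      by_cases htop : p = ⊤
      · subst htop
        simp only [smul_top, hf.map_top]
        exact tendsto_const_nhds
      obtain ⟨a, b, hap, hpb, ha, hb⟩ := hrgap p hp hpt hbot htop
      have h₁ := hlim a
      have h₂ := hlim b
      simp only [Function.comp_apply, ha, hb] at h₁ h₂
      -- Both flanking points tend to `f p`, since `r a = r b = p`, and `g • p` lies between their
      -- images.
      refine tendsto_of_tendsto_of_tendsto_of_le_of_le h₁ h₂ (fun g => ?_) (fun g => ?_)
      · exact smul_pt g a 0 ▸ (smul_le_smul_iff g).2 hap.le
      · exact smul_pt g b 0 ▸ (smul_le_smul_iff g).2 hpb.le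
    obtain ⟨g, hg⟩ := ((Filter.eventually_all_finset σ).2 fun p hp =>
      (key p hp).eventually ((hu p hp).1.mem_nhds (hu p hp).2)).exists
    exact ⟨bmAct g, hsub fun p hp => hg p hp, g, rfl⟩

/-- The envelope of the action on `b_m X` is a monoid under composition. -/
@[reducible] def envelopeMonoid [Infinite X] (hX : IsUltrahomogeneous X) :
    Monoid (envelope (bmAct (X := X))) where
  mul f h := ⟨f.1 ∘ h.1, by
    have hf := f.2
    have hh := h.2
    simp only [envelope_bmAct_eq hX] at hf hh ⊢
    exact IsEnvelopeMap.comp hf hh⟩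
  one := toEnvelope bmAct 1
  mul_assoc _ _ _ := rfl
  one_mul f := Subtype.ext (funext fun p => one_smul _ (f.1 p))
  mul_one f := Subtype.ext (funext fun p => congrArg f.1 (one_smul _ p))

theorem isInducing_toEnvelope [DenselyOrdered X] : IsInducing (toEnvelope (bmAct (X := X))) := by
  refine isInducing_of_forall_eventually (Continuous.subtype_mk (continuous_pi fun p =>
    continuous_id.smul continuous_const) _) fun x g => ?_
  have hc : Continuous fun f : envelope (bmAct (X := X)) => f.1 (pt x 0) :=
    (continuous_apply _).comp continuous_subtype_val
  filter_upwards [(hc.tendsto (toEnvelope bmAct g)).eventually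
    ((isOpen_singleton_pt (g x)).mem_nhds (smul_pt g x 0))] with k hk g' hg'
  subst hg'
  exact (pt_inj.1 ((smul_pt g' x 0).symm.trans hk)).1

theorem toEnvelope_injective : Function.Injective (toEnvelope (bmAct (X := X))) := by
  intro g g' h
  ext x
  have := congrFun (congrArg Subtype.val h) (pt x 0)
  exact (pt_inj.1 ((smul_pt g x 0).symm.trans (this.trans (smul_pt g' x 0)))).1

theorem isEllisCompactification_toEnvelope [Infinite X] (hX : IsUltrahomogeneous X) :
    @IsEllisCompactification _ _ _ _ _ (envelopeMonoid hX) (toEnvelope (bmAct (X := X))) := by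
  have := hX.denselyOrdered
  let := envelopeMonoid hX
  refine ⟨⟨inferInstance, inferInstance, ⟨⟨isInducing_toEnvelope, denseRange_toEnvelope _⟩,
    toEnvelope_injective⟩, one_mul, fun g h k => ?_, fun g h => ?_, ?_⟩, fun y => ?_⟩
  · exact Subtype.ext (funext fun p => mul_smul g h (k.1 p))
  · exact Subtype.ext (funext fun p => (mul_smul g h p).symm)
  · refine Continuous.subtype_mk (continuous_pi fun p => ?_) _
    exact continuous_fst.smul ((continuous_apply p).comp (continuous_subtype_val.comp continuous_snd))
  · refine Continuous.subtype_mk (continuous_pi fun p => ?_) _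
    exact (continuous_apply (y.1 p)).comp continuous_subtype_val

end BMax

/-! ### Entourages of the group uniformities. -/

open Uniformity

section Uniformities

variable {G : Type*} [Group G] [TopologicalSpace G] [IsTopologicalGroup G]

theorem mem_roelckeUniformity_iff {s : Set (G × G)} :
    s ∈ @uniformity G (roelckeUniformity G) ↔ ∃ O ∈ 𝓝 (1 : G), doubleEntourage O O ⊆ s := by
  constructor
  · rintro ⟨_, ⟨O, hO, rfl⟩, hs⟩
    exact ⟨O, hO, hs⟩
  · rintro ⟨O, hO, hs⟩
    exact ⟨_, ⟨O, hO, rfl⟩, hs⟩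

theorem mem_stabilizerUniformity_iff {Y : Type*} [MulAction G Y] {s : Set (G × G)} :
    s ∈ @uniformity G (stabilizerUniformity G Y) ↔ ∃ O ∈ 𝓝 (1 : G), ∃ σ : Finset Y,
      doubleEntourage O (fixingSubgroup G (σ : Set Y) : Set G) ⊆ s := by
  constructor
  · rintro ⟨_, ⟨O, hO, σ, rfl⟩, hs⟩
    exact ⟨O, hO, σ, hs⟩
  · rintro ⟨O, hO, σ, hs⟩
    exact ⟨_, ⟨O, hO, σ, rfl⟩, hs⟩

theorem uniformContinuous_mul_left_roelcke (g : G) :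
    @UniformContinuous G G (roelckeUniformity G) (roelckeUniformity G) fun h => g * h := by
  intro s hs
  obtain ⟨O, hO, hs⟩ := mem_roelckeUniformity_iff.1 hs
  -- Translation by `g` conjugates the left factor: `g * (a * h * b) = (g * a * g⁻¹) * (g * h) * b`.
  have hc : Filter.Tendsto (fun a => g * a * g⁻¹) (𝓝 (1 : G)) (𝓝 1) := by
    have : Continuous fun a : G => g * a * g⁻¹ := by fun_prop
    simpa using this.tendsto 1
  refine mem_roelckeUniformity_iff.2 ⟨_, Filter.inter_mem hO (hc hO), ?_⟩
  rintro ⟨h, k⟩ ⟨a, ha, b, hb, e⟩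
  refine hs ⟨g * a * g⁻¹, ha.2, b, hb.1, ?_⟩
  simp only at e ⊢
  rw [e]
  group

theorem precompactReplica_eq_self {Y : Type*} {U : UniformSpace Y}
    (h : @TotallyBounded Y U univ) : precompactReplica U = U :=
  le_antisymm (sInf_le ⟨le_rfl, h⟩) (le_sInf fun _ hV => hV.1)

end Uniformities

theorem exists_finset_of_mem_nhds_one {X : Type*} [LinearOrder X] {O : Set (X ≃o X)}
    (hO : O ∈ 𝓝 (1 : X ≃o X)) :
    ∃ F : Finset X, ∀ a : X ≃o X, (∀ x ∈ F, a x = x) → a ∈ O := by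
  let _ : TopologicalSpace X := ⊥
  rw [nhds_induced, Filter.mem_comap] at hO
  obtain ⟨t, ht, htO⟩ := hO
  rw [nhds_pi, Filter.mem_pi] at ht
  obtain ⟨I, hI, u, hu, hsub⟩ := ht
  refine ⟨hI.toFinset, fun a ha => htO (hsub fun x hx => ?_)⟩
  have : a x = x := ha x (by simpa using hx)
  simpa [this] using mem_of_mem_nhds (hu x)

/-! ### Automorphisms with prescribed support and fixed points in `b_m X`. -/

namespace IsUltrahomogeneous

variable {X : Type*} [LinearOrder X]

/-- An automorphism fixing `a` and `b` preserves the interval, so it may be replaced by the identity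
outside. The control of the support is what allows gaps to be fixed as well. -/
theorem exists_apply_eq_of_mem_Ioo (hX : IsUltrahomogeneous X) {a b x y : X} (hx : x ∈ Ioo a b)
    (hy : y ∈ Ioo a b) : ∃ c : X ≃o X, c x = y ∧ ∀ z, z ∉ Ioo a b → c z = z := by
  classical
  obtain ⟨g, hg⟩ := hX 3 ![a, x, b] ![a, y, b]
    (by simpa [Fin.strictMono_iff_lt_succ, Fin.forall_fin_succ] using hx)
    (by simpa [Fin.strictMono_iff_lt_succ, Fin.forall_fin_succ] using hy)
  have ha : g a = a := hg 0
  have hgx : g x = y := hg 1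
  have hb : g b = b := hg 2
  have hmem : ∀ z, g z ∈ Ioo a b ↔ z ∈ Ioo a b := fun z => by
    constructor
    · rintro ⟨h₁, h₂⟩
      rw [← ha] at h₁
      rw [← hb] at h₂
      exact ⟨g.lt_iff_lt.1 h₁, g.lt_iff_lt.1 h₂⟩
    · rintro ⟨h₁, h₂⟩
      exact ⟨ha ▸ g.lt_iff_lt.2 h₁, hb ▸ g.lt_iff_lt.2 h₂⟩
  set c : X → X := fun z => if z ∈ Ioo a b then g z else z with hc
  have hin : ∀ z, z ∈ Ioo a b → c z = g z := fun z hz => if_pos hz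
  have hout : ∀ z, z ∉ Ioo a b → c z = z := fun z hz => if_neg hz
  have hmono : StrictMono c := by
    intro z w hzw
    by_cases hz : z ∈ Ioo a b <;> by_cases hw : w ∈ Ioo a b
    · rw [hin z hz, hin w hw]
      exact g.lt_iff_lt.2 hzw
    · rw [hin z hz, hout w hw]
      have : b ≤ w := by
        by_contra! h
        exact hw ⟨hz.1.trans hzw, h⟩
      exact ((hmem z).2 hz).2.trans_le this
    · rw [hout z hz, hin w hw]
      have : z ≤ a := by
        by_contra! h
        exact hz ⟨h, hzw.trans hw.2⟩
      exact this.trans_lt ((hmem w).2 hw).1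
    · rwa [hout z hz, hout w hw]
  have hsurj : Function.Surjective c := by
    intro z
    by_cases hz : z ∈ Ioo a b
    · obtain ⟨w, rfl⟩ := g.surjective z
      exact ⟨w, hin w ((hmem w).1 hz)⟩
    · exact ⟨z, hout z hz⟩
  exact ⟨hmono.orderIsoOfSurjective c hsurj, (hin x hx).trans hgx, hout⟩

end IsUltrahomogeneous

namespace BMax

variable {X : Type*} [LinearOrder X]

theorem smul_eq_self_of_forall_le {c : X ≃o X} {q : BMax X}
    (h : ∀ x j, pt x j ≤ q → c x = x) : c • q = q := by
  refine le_antisymm ?_ ?_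
  · by_contra! hlt
    obtain ⟨x, j, h₁, h₂⟩ := exists_pt_of_lt hlt
    obtain ⟨x, rfl⟩ := c.surjective x
    rw [← smul_pt, smul_le_smul_iff] at h₂
    rw [h x j h₂] at h₁
    exact h₁.not_ge h₂
  · by_contra! hlt
    obtain ⟨x, j, h₁, h₂⟩ := exists_pt_of_lt hlt
    rw [← h x j h₂, ← smul_pt, smul_lt_smul_iff] at h₁
    exact h₁.not_ge h₂

theorem smul_eq_self_of_forall_ge {c : X ≃o X} {q : BMax X}
    (h : ∀ x j, q ≤ pt x j → c x = x) : c • q = q := by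
  refine le_antisymm ?_ ?_
  · by_contra! hlt
    obtain ⟨x, j, h₁, h₂⟩ := exists_pt_of_lt' hlt
    rw [← h x j h₁, ← smul_pt, smul_lt_smul_iff] at h₂
    exact h₂.not_ge h₁
  · by_contra! hlt
    obtain ⟨x, j, h₁, h₂⟩ := exists_pt_of_lt' hlt
    obtain ⟨x, rfl⟩ := c.surjective x
    rw [← smul_pt, smul_le_smul_iff] at h₁
    rw [h x j h₁] at h₂
    exact h₂.not_ge h₁

/-- A set of points of `b_m X` that with `(x, j)` contains `(x, 0)`. -/
def IsSaturated (σ : Set (BMax X)) : Prop := ∀ x j, pt x j ∈ σ → pt x 0 ∈ σ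

theorem exists_isSaturated_superset (σ : Finset (BMax X)) :
    ∃ τ : Finset (BMax X), σ ⊆ τ ∧ IsSaturated (τ : Set (BMax X)) := by
  classical
  have hfin : (⋃ j : SignType, (fun x => pt x j) ⁻¹' (σ : Set (BMax X))).Finite :=
    Set.finite_iUnion fun j => σ.finite_toSet.preimage fun x _ y _ h => (pt_inj.1 h).1
  refine ⟨σ ∪ (hfin.image fun x => pt x 0).toFinset, Finset.subset_union_left, fun x j hx => ?_⟩
  simp only [Finset.coe_union, Set.Finite.coe_toFinset, mem_union, Finset.mem_coe] at hx ⊢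
  rcases hx with hx | ⟨y, hmem, hy⟩
  · exact Or.inr ⟨x, mem_iUnion.2 ⟨j, hx⟩, rfl⟩
  · exact Or.inr ⟨y, hmem, by rw [(pt_inj.1 hy).1]⟩

/-- No point of `σ` separates `x` from `y`, so an interval around both can be chosen with all of `σ`
outside it; an automorphism supported there fixes `σ`. -/
theorem exists_fixing_of_lt [Infinite X] (hX : IsUltrahomogeneous X) {σ : Finset (BMax X)}
    (hσ : IsSaturated (σ : Set (BMax X))) {x y : X} (hxy : x < y)
    (h : ∀ p ∈ σ, (pt x 0 < p ↔ pt y 0 < p) ∧ (p < pt x 0 ↔ p < pt y 0)) :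
    ∃ c : X ≃o X, c x = y ∧ ∀ p ∈ σ, c • p = p := by
  have := hX.denselyOrdered
  have := hX.noMinOrder
  have := hX.noMaxOrder
  have hxσ : pt x 0 ∉ σ := fun hx => lt_irrefl _ ((h _ hx).2.2 (pt_zero_lt_pt_zero.2 hxy))
  have hyσ : pt y 0 ∉ σ := fun hy => lt_irrefl _ ((h _ hy).1.1 (pt_zero_lt_pt_zero.2 hxy))
  have neg : ∀ z : X, pt z (-1) ∉ base := fun z => by rw [pt_mem_base]; decide
  have pos : ∀ z : X, pt z 1 ∉ base := fun z => by rw [pt_mem_base]; decide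
  obtain ⟨a, hax, ha⟩ : ∃ a < x, ∀ p ∈ σ, p < pt x 0 → p ≤ pt a 0 := by
    -- Room below `x` requires `(x, -1) ∉ σ`. By saturation `(x, -1) ∈ σ` would give `(x, 0) ∈ σ`,
    -- which distinguishes `x` from `y`.
    have hev : ∀ᶠ q in 𝓝 (pt x (-1)), ∀ p ∈ σ, p < pt x 0 → p < q := by
      refine (Filter.eventually_all_finset σ).2 fun p hp => Filter.eventually_imp_distrib_left.2
        fun hpx => isOpen_Ioi.mem_nhds (lt_of_le_of_ne (lt_pt_zero_iff.1 hpx) ?_)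
      rintro rfl
      exact hxσ (hσ x _ hp)
    obtain ⟨l, hl, hsub⟩ := exists_Ioc_subset_of_mem_nhds hev
      ⟨⊥, bot_lt_iff_ne_bot.2 (pt_ne_bot x _)⟩
    obtain ⟨a, hla, hax⟩ := exists_lt_pt_lt' (neg x) (fun z h => absurd (pt_inj.1 h).2 (by decide)) hl
    exact ⟨a, pt_zero_lt_pt_zero.1 (lt_pt_zero_iff.2 hax.le), fun p hp hpx =>
      (hsub ⟨hla, hax.le⟩ p hp hpx).le⟩
  obtain ⟨b, hyb, hb⟩ : ∃ b > y, ∀ p ∈ σ, pt y 0 < p → pt b 0 ≤ p := by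
    have hev : ∀ᶠ q in 𝓝 (pt y 1), ∀ p ∈ σ, pt y 0 < p → q < p := by
      refine (Filter.eventually_all_finset σ).2 fun p hp => Filter.eventually_imp_distrib_left.2
        fun hpx => isOpen_Iio.mem_nhds (lt_of_le_of_ne (pt_zero_lt_iff.1 hpx) ?_)
      rintro rfl
      exact hyσ (hσ y _ hp)
    obtain ⟨u, hu, hsub⟩ := exists_Ico_subset_of_mem_nhds hev
      ⟨⊤, lt_top_iff_ne_top.2 (pt_ne_top y _)⟩
    obtain ⟨b, hyb, hbu⟩ := exists_lt_pt_lt (pos y) (fun z h => absurd (pt_inj.1 h).2 (by decide)) hu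
    exact ⟨b, pt_zero_lt_pt_zero.1 (pt_zero_lt_iff.2 hyb.le), fun p hp hpy =>
      (hsub ⟨hyb.le, hbu⟩ p hp hpy).le⟩
  obtain ⟨c, hc, hfix⟩ := hX.exists_apply_eq_of_mem_Ioo (x := x) (y := y) ⟨hax, hxy.trans hyb⟩
    ⟨hax.trans hxy, hyb⟩
  refine ⟨c, hc, fun p hp => ?_⟩
  rcases lt_trichotomy p (pt x 0) with hpx | rfl | hpx
  · refine smul_eq_self_of_forall_le fun z j hz => hfix z fun hz' => ?_
    exact (pt_lt_pt_of_lt hz'.1 0 j).not_ge (hz.trans (ha p hp hpx))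
  · exact absurd hp hxσ
  · refine smul_eq_self_of_forall_ge fun z j hz => hfix z fun hz' => ?_
    exact (pt_lt_pt_of_lt hz'.2 j 0).not_ge ((hb p hp ((h p hp).1.1 hpx)).trans hz)

theorem exists_fixing [Infinite X] (hX : IsUltrahomogeneous X) {σ : Finset (BMax X)}
    (hσ : IsSaturated (σ : Set (BMax X))) {x y : X}
    (h : ∀ p ∈ σ, (pt x 0 < p ↔ pt y 0 < p) ∧ (p < pt x 0 ↔ p < pt y 0)) :
    ∃ c : X ≃o X, c x = y ∧ ∀ p ∈ σ, c • p = p := by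
  rcases lt_trichotomy x y with hxy | rfl | hxy
  · exact exists_fixing_of_lt hX hσ hxy h
  · exact ⟨1, rfl, fun p _ => one_smul _ p⟩
  · obtain ⟨c, hc, hfix⟩ := exists_fixing_of_lt hX hσ hxy
      fun p hp => ⟨(h p hp).1.symm, (h p hp).2.symm⟩
    refine ⟨c⁻¹, ?_, fun p hp => inv_smul_eq_iff.2 (hfix p hp).symm⟩
    rw [← hc]
    exact RelIso.inv_apply_self c y

theorem exists_fixing_of_finset [Infinite X] (hX : IsUltrahomogeneous X) {σ : Finset (BMax X)}
    (hσ : IsSaturated (σ : Set (BMax X))) (u v : X ≃o X) (F : Finset X)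
    (h : ∀ x ∈ F, ∀ p ∈ σ,
      (pt (u x) 0 < p ↔ pt (v x) 0 < p) ∧ (p < pt (u x) 0 ↔ p < pt (v x) 0)) :
    ∃ c : X ≃o X, (∀ x ∈ F, c (u x) = v x) ∧ ∀ p ∈ σ, c • p = p := by
  classical
  induction F using Finset.induction_on with
  | empty => exact ⟨1, by simp, fun p _ => one_smul _ p⟩
  | insert a F ha ih =>
    obtain ⟨c, hc, hfix⟩ := ih fun x hx => h x (Finset.mem_insert_of_mem hx)
    -- The targets already reached are adjoined to the set to be fixed, so the correction at `a`
    -- does not disturb them.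
    have hσ' : IsSaturated ((σ ∪ F.image fun z => pt (v z) 0 : Finset (BMax X)) :
        Set (BMax X)) := by
      intro x j hx
      simp only [Finset.coe_union, Finset.coe_image, mem_union, Finset.mem_coe, mem_image]
        at hx ⊢
      rcases hx with hx | ⟨z, hz, e⟩
      · exact Or.inl (hσ x j hx)
      · exact Or.inr ⟨z, hz, by rw [(pt_inj.1 e).1]⟩
    obtain ⟨d, hd, hdfix⟩ := exists_fixing hX hσ' (x := c (u a)) (y := v a) (by
      intro p hp
      rcases Finset.mem_union.1 hp with hp | hp
      · have hp' := h a (Finset.mem_insert_self a F) p hp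
        rw [← hp'.1, ← hp'.2, ← smul_pt]
        have e := hfix p hp
        constructor
        · conv_lhs => rw [← e]
          exact smul_lt_smul_iff c
        · conv_lhs => rw [← e]
          exact smul_lt_smul_iff c
      · obtain ⟨z, hz, rfl⟩ := Finset.mem_image.1 hp
        simp only [pt_zero_lt_pt_zero, v.lt_iff_lt]
        rw [← hc z hz]
        simp)
    refine ⟨d * c, fun x hx => ?_, fun p hp => ?_⟩
    · rcases Finset.mem_insert.1 hx with rfl | hx
      · exact hd
      · have := hdfix (pt (v x) 0) (Finset.mem_union_right _ (Finset.mem_image_of_mem _ hx))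
        rw [RelIso.mul_apply, hc x hx]
        exact (pt_inj.1 ((smul_pt d (v x) 0).symm.trans this)).1
    · rw [mul_smul, hfix p hp, hdfix p (Finset.mem_union_left _ hp)]

theorem mem_doubleEntourage_of_forall [Infinite X] (hX : IsUltrahomogeneous X)
    {σ : Finset (BMax X)} (hσ : IsSaturated (σ : Set (BMax X))) {F : Finset X}
    {O : Set (X ≃o X)} (hO : ∀ a : X ≃o X, (∀ x ∈ F, a x = x) → a ∈ O) {g h : X ≃o X}
    (hgh : ∀ x ∈ F, ∀ p ∈ σ, (pt x 0 < g • p ↔ pt x 0 < h • p) ∧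
      (g • p < pt x 0 ↔ h • p < pt x 0)) :
    (g, h) ∈ doubleEntourage O (fixingSubgroup (X ≃o X) (σ : Set (BMax X)) : Set (X ≃o X)) := by
  have key : ∀ (k : X ≃o X) (x : X), k • pt (k⁻¹ x) 0 = pt x 0 := fun k x => by
    simp [smul_pt]
  have key₁ : ∀ (k : X ≃o X) (x : X) (p : BMax X), pt (k⁻¹ x) 0 < p ↔ pt x 0 < k • p :=
    fun k x p => by rw [← key k x, smul_lt_smul_iff]
  have key₂ : ∀ (k : X ≃o X) (x : X) (p : BMax X), p < pt (k⁻¹ x) 0 ↔ k • p < pt x 0 :=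
    fun k x p => by rw [← key k x, smul_lt_smul_iff]
  obtain ⟨c, hc, hfix⟩ := exists_fixing_of_finset hX hσ g⁻¹ h⁻¹ F fun x hx p hp => by
    simpa only [key₁, key₂] using hgh x hx p hp
  -- As `c` maps `g⁻¹ x` to `h⁻¹ x` for `x ∈ F`, the element `h * c * g⁻¹` fixes `F`.
  refine ⟨h * c * g⁻¹, hO _ fun x hx => ?_, c⁻¹, ?_, by group⟩
  · rw [RelIso.mul_apply, RelIso.mul_apply, hc x hx]
    exact RelIso.apply_inv_self h x
  · refine inv_mem ((mem_fixingSubgroup_iff _).2 fun p hp => hfix p hp)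

/-! ### Uniform structures -/

variable (X) in
/-- The uniformity of the compact Hausdorff space `b_m X`. -/
@[reducible] noncomputable def uniformSpace : UniformSpace (BMax X) := uniformSpaceOfCompactR1

section

attribute [local instance] uniformSpace

/-- Compactness makes the estimate uniform in `q`. Applied at `q = g • p`, it gives a neighbourhood
of the unit independent of `g`. -/
theorem eventually_forall_smul_mem [DenselyOrdered X] {W : Set (BMax X × BMax X)}
    (hW : W ∈ 𝓤 (BMax X)) : ∀ᶠ a in 𝓝 (1 : X ≃o X), ∀ q : BMax X, (q, a • q) ∈ W := by
  have := (isCompact_univ (X := BMax X)).eventually_forall_of_forall_eventually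
    (x₀ := (1 : X ≃o X)) (P := fun a q => (q, a • q) ∈ W) fun q _ => by
      have hc : Continuous fun z : (X ≃o X) × BMax X => (z.2, z.1 • z.2) :=
        continuous_snd.prodMk continuous_smul
      refine (hc.tendsto (1, q)).eventually ?_
      simp only [one_smul]
      exact nhds_le_uniformity q hW
  simpa using this

theorem setOf_mem_iff_mem_uniformity {C : Set (BMax X)} (hC : IsClopen C) :
    {z : BMax X × BMax X | z.1 ∈ C ↔ z.2 ∈ C} ∈ 𝓤 (BMax X) := by
  rw [compactSpace_uniformity, Filter.mem_iSup]
  intro x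
  by_cases hx : x ∈ C
  · filter_upwards [prod_mem_nhds (hC.isOpen.mem_nhds hx) (hC.isOpen.mem_nhds hx)] with z hz
    exact iff_of_true hz.1 hz.2
  · filter_upwards [prod_mem_nhds (hC.compl.isOpen.mem_nhds hx) (hC.compl.isOpen.mem_nhds hx)]
      with z hz
    exact iff_of_false hz.1 hz.2

theorem exists_nhds_smul_mem [DenselyOrdered X] {W : Set (BMax X × BMax X)}
    (hW : W ∈ 𝓤 (BMax X)) (p : BMax X) : ∃ O ∈ 𝓝 (1 : X ≃o X), ∀ g : X ≃o X, ∀ a ∈ O,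
      ∀ b : X ≃o X, b • p = p → (g • p, (a * g * b) • p) ∈ W := by
  refine ⟨_, eventually_forall_smul_mem hW, fun g a ha b hb => ?_⟩
  rw [mul_smul, hb, mul_smul]
  exact ha (g • p)

/-- The criterion serves both completions, with `P` equal to `b_m X` or to `X`. Since open rays at
points of `X` are clopen, agreeing on finitely many positions is an entourage of the product. -/
theorem isUniformInducing_pi_smul {P : Type*} (π : P → BMax X) (U : UniformSpace (X ≃o X))
    (h₁ : ∀ p, ∀ W ∈ 𝓤 (BMax X), {z : (X ≃o X) × (X ≃o X) | (z.1 • π p, z.2 • π p) ∈ W} ∈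
      @uniformity _ U)
    (h₂ : ∀ s ∈ @uniformity _ U, ∃ (F : Finset X) (τ : Finset P), ∀ g h : X ≃o X,
      (∀ x ∈ F, ∀ p ∈ τ, (pt x 0 < g • π p ↔ pt x 0 < h • π p) ∧
        (g • π p < pt x 0 ↔ h • π p < pt x 0)) → (g, h) ∈ s) :
    @IsUniformInducing _ _ U _ fun (g : X ≃o X) (p : P) => g • π p := by
  refine @IsUniformInducing.mk _ _ U _ _ (le_antisymm (fun s hs => ?_) ?_)
  · obtain ⟨F, τ, h⟩ := h₂ s hs
    refine Filter.mem_comap.2 ⟨{z | ∀ x ∈ F, ∀ p ∈ τ, (pt x 0 < z.1 p ↔ pt x 0 < z.2 p) ∧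
      (z.1 p < pt x 0 ↔ z.2 p < pt x 0)}, ?_, fun z hz => h _ _ hz⟩
    refine (Filter.eventually_all_finset F).2 fun x _ => (Filter.eventually_all_finset τ).2
      fun p _ => ?_
    have hp : Filter.Tendsto (fun z : (P → BMax X) × (P → BMax X) => (z.1 p, z.2 p))
        (𝓤 (P → BMax X)) (𝓤 (BMax X)) := Pi.uniformContinuous_proj _ p
    exact (hp.eventually (setOf_mem_iff_mem_uniformity (isClopen_Ioi_pt x))).and
      (hp.eventually (setOf_mem_iff_mem_uniformity (isClopen_Iio_pt x)))
  · rw [← Filter.map_le_iff_le_comap, Pi.uniformity]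
    refine le_iInf fun p => Filter.map_le_iff_le_comap.1 fun W hW => h₁ p W hW

theorem isUniformInducing_bmAct [Infinite X] (hX : IsUltrahomogeneous X) :
    @IsUniformInducing _ _ (stabilizerUniformity (X ≃o X) (BMax X)) _ (bmAct (X := X)) := by
  have := hX.denselyOrdered
  refine isUniformInducing_pi_smul (fun p => p) _ (fun p W hW => ?_) fun s hs => ?_
  · obtain ⟨O, hO, h⟩ := exists_nhds_smul_mem hW p
    refine mem_stabilizerUniformity_iff.2 ⟨O, hO, {p}, ?_⟩
    rintro ⟨g, k⟩ ⟨a, ha, b, hb, e⟩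
    change k = a * g * b at e
    subst e
    exact h g a ha b ((mem_fixingSubgroup_iff _).1 hb p (by simp))
  · obtain ⟨O, hO, σ, hs⟩ := mem_stabilizerUniformity_iff.1 hs
    obtain ⟨F, hF⟩ := exists_finset_of_mem_nhds_one hO
    obtain ⟨τ, hστ, hτ⟩ := exists_isSaturated_superset σ
    refine ⟨F, τ, fun g h hgh => hs (doubleEntourage_mono subset_rfl ?_
      (mem_doubleEntourage_of_forall hX hτ hF hgh))⟩
    exact fixingSubgroup_antitone _ _ (by exact_mod_cast hστ)

theorem isUniformInducing_ofAut [Infinite X] (hX : IsUltrahomogeneous X) :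
    @IsUniformInducing _ _ (roelckeUniformity (X ≃o X)) _ (ofAut (X := X)) := by
  classical
  have := hX.denselyOrdered
  have e : (ofAut (X := X)) = fun (g : X ≃o X) x => g • pt x 0 := by
    ext1 g; ext1 x; exact (smul_pt g x 0).symm
  rw [e]
  refine isUniformInducing_pi_smul (fun x => pt x 0) _ (fun x W hW => ?_) fun s hs => ?_
  · obtain ⟨O, hO, h⟩ := exists_nhds_smul_mem hW (pt x 0)
    have hx : {b : X ≃o X | b x = x} ∈ 𝓝 1 := (isOpen_setOf_apply_eq x x).mem_nhds rfl
    refine mem_roelckeUniformity_iff.2 ⟨_, Filter.inter_mem hO hx, ?_⟩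
    rintro ⟨g, k⟩ ⟨a, ha, b, hb, e⟩
    change k = a * g * b at e
    subst e
    refine h g a ha.1 b ?_
    rw [smul_pt, show b x = x from hb.2]
  · obtain ⟨O, hO, hs⟩ := mem_roelckeUniformity_iff.1 hs
    obtain ⟨F, hF⟩ := exists_finset_of_mem_nhds_one hO
    -- With `σ = F × {0}` the pointwise stabilizer lies in `O`, so the entourage `O g St_σ` is
    -- contained in `O g O`.
    have hsat : IsSaturated ((F.image fun x => pt x 0 : Finset (BMax X)) : Set (BMax X)) := by
      intro x j hx
      simp only [Finset.coe_image, mem_image, Finset.mem_coe] at hx ⊢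
      obtain ⟨y, hy, e⟩ := hx
      exact ⟨y, hy, by rw [(pt_inj.1 e).1]⟩
    refine ⟨F, F, fun g h hgh => hs (doubleEntourage_mono subset_rfl (fun b hb => hF b ?_)
      (mem_doubleEntourage_of_forall hX hsat hF fun x hx p hp => ?_))⟩
    · intro x hx
      have := (mem_fixingSubgroup_iff _).1 hb (pt x 0)
        (by simpa using ⟨x, hx, rfl⟩)
      exact (pt_inj.1 ((smul_pt b x 0).symm.trans this)).1
    · obtain ⟨y, hy, rfl⟩ := Finset.mem_image.1 hp
      exact hgh x hx y hy

theorem isCompletionOf_toEnvelope [Infinite X] (hX : IsUltrahomogeneous X) :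
    IsCompletionOf (stabilizerUniformity (X ≃o X) (BMax X)) (toEnvelope (bmAct (X := X))) := by
  refine ⟨instUniformSpaceSubtype, rfl, inferInstance, inferInstance, toEnvelope_injective, ?_,
    denseRange_toEnvelope _⟩
  let _ := stabilizerUniformity (X ≃o X) (BMax X)
  exact isUniformInducing_val _ |>.of_comp_iff.1 (isUniformInducing_bmAct hX)

variable (X) in
/-- The compact space of maps that describes the Roelcke compactification of `Aut X`. -/
abbrev RoelckeMaps : Type _ := {f : X → BMax X // IsRoelckeMap f}

instance : CompactSpace (RoelckeMaps X) :=
  isCompact_iff_compactSpace.1 (isClosed_setOf_isRoelckeMap (X := X)).isCompact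

/-- The map `x ↦ (g x, 0)` as a point of the space of Roelcke maps. -/
def toRoelckeMaps (g : X ≃o X) : RoelckeMaps X := ⟨ofAut g, isRoelckeMap_ofAut g⟩

theorem denseRange_toRoelckeMaps [Infinite X] (hX : IsUltrahomogeneous X) :
    DenseRange (toRoelckeMaps (X := X)) := by
  intro f
  rw [closure_subtype, ← range_comp]
  exact (closure_range_ofAut hX).ge f.2

theorem isUniformInducing_toRoelckeMaps [Infinite X] (hX : IsUltrahomogeneous X) :
    @IsUniformInducing _ _ (roelckeUniformity (X ≃o X)) _ (toRoelckeMaps (X := X)) := by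
  let _ := roelckeUniformity (X ≃o X)
  exact isUniformInducing_val _ |>.of_comp_iff.1 (isUniformInducing_ofAut hX)

theorem isRoelckePrecompact [Infinite X] (hX : IsUltrahomogeneous X) :
    IsRoelckePrecompact (X ≃o X) := by
  let _ := roelckeUniformity (X ≃o X)
  have := totallyBounded_preimage (isUniformInducing_toRoelckeMaps hX)
    (isCompact_univ (X := RoelckeMaps X)).totallyBounded
  exact this

/-- By precompactness the replica is the Roelcke uniformity itself, and the Roelcke maps form a
completion of it; completions are unique. -/
theorem exists_homeomorph_roelckeMaps [Infinite X] (hX : IsUltrahomogeneous X) :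
    ∃ Φ : RoelckeCompactification (X ≃o X) ≃ₜ RoelckeMaps X,
      ∀ g, Φ (toRoelcke g) = toRoelckeMaps g := by
  have h := isUniformInducing_toRoelckeMaps hX
  rw [← precompactReplica_eq_self (isRoelckePrecompact hX)] at h
  let _ := precompactReplica (roelckeUniformity (X ≃o X))
  let pkg : AbstractCompletion (X ≃o X) :=
    { space := RoelckeMaps X
      coe := toRoelckeMaps
      uniformStruct := inferInstance
      complete := inferInstance
      separation := inferInstance
      isUniformInducing := h
      dense := denseRange_toRoelckeMaps hX }
  exact ⟨@UniformEquiv.toHomeomorph _ _ UniformSpace.Completion.cPkg.uniformStruct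
      pkg.uniformStruct (UniformSpace.Completion.cPkg.compareEquiv pkg),
    fun g => UniformSpace.Completion.cPkg.compare_coe pkg g⟩

end

end BMax

/-! ### The action on the Roelcke compactification and its enveloping semigroup. -/

theorem continuous_roelckeAct {G : Type*} [Group G] [TopologicalSpace G] [IsTopologicalGroup G]
    (g : G) : Continuous (roelckeAct g) := by
  let _ := precompactReplica (roelckeUniformity G)
  exact UniformSpace.Completion.continuous_map

theorem roelckeAct_toRoelcke {G : Type*} [Group G] [TopologicalSpace G] [IsTopologicalGroup G]
    (hG : IsRoelckePrecompact G) (g h : G) :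
    roelckeAct g (toRoelcke h) = toRoelcke (g * h) := by
  have huc := uniformContinuous_mul_left_roelcke g
  rw [← precompactReplica_eq_self hG] at huc
  let _ := precompactReplica (roelckeUniformity G)
  exact UniformSpace.Completion.map_coe huc h

theorem denseRange_toRoelcke {G : Type*} [Group G] [TopologicalSpace G] [IsTopologicalGroup G] :
    DenseRange (toRoelcke (G := G)) := by
  let _ := precompactReplica (roelckeUniformity G)
  exact UniformSpace.Completion.denseRange_coe

namespace BMax

variable {X : Type*} [LinearOrder X]

theorem isDenseEmbedding_toRoelckeMaps [Infinite X] (hX : IsUltrahomogeneous X) :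
    IsDenseEmbedding (toRoelckeMaps (X := X)) := by
  have := hX.denselyOrdered
  refine ⟨⟨isInducing_of_forall_eventually ?_ fun x g => ?_, denseRange_toRoelckeMaps hX⟩, ?_⟩
  · refine Continuous.subtype_mk (continuous_pi fun x => ?_) _
    simp only [ofAut, ← smul_pt]
    exact continuous_id.smul continuous_const
  · have hc : Continuous fun f : RoelckeMaps X => f.1 x :=
      (continuous_apply _).comp continuous_subtype_val
    filter_upwards [(hc.tendsto (toRoelckeMaps g)).eventually
      ((isOpen_singleton_pt (g x)).mem_nhds rfl)] with k hk g' hg'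
    subst hg'
    exact (pt_inj.1 hk).1
  · intro g g' h
    ext x
    exact (pt_inj.1 (congrFun (congrArg Subtype.val h) x)).1

/-- The elements of the envelope of the action on `b_m X` act on the Roelcke maps by
composition. -/
def envelopeComp [Infinite X] (hX : IsUltrahomogeneous X) (f : envelope (bmAct (X := X)))
    (r : RoelckeMaps X) : RoelckeMaps X :=
  ⟨f.1 ∘ r.1, ((envelope_bmAct_eq hX).le f.2).comp_isRoelckeMap r.2⟩

theorem continuous_envelopeComp [Infinite X] (hX : IsUltrahomogeneous X) (r : RoelckeMaps X) :
    Continuous fun f => envelopeComp hX f r := by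
  have hc : ∀ p, Continuous fun f : envelope (bmAct (X := X)) => f.1 p := fun p =>
    (continuous_apply p).comp continuous_subtype_val
  exact Continuous.subtype_mk (continuous_pi fun x => hc (r.1 x)) _

theorem continuous_envelopeComp_toEnvelope [Infinite X] (hX : IsUltrahomogeneous X)
    {T : Type*} [TopologicalSpace T] {u : T → (X ≃o X)} {v : T → RoelckeMaps X}
    (hu : Continuous u) (hv : Continuous v) :
    Continuous fun t => envelopeComp hX (toEnvelope bmAct (u t)) (v t) := by
  have := hX.denselyOrdered
  have hc : ∀ x, Continuous fun r : RoelckeMaps X => r.1 x := fun x =>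
    (continuous_apply x).comp continuous_subtype_val
  exact Continuous.subtype_mk (continuous_pi fun x => hu.smul ((hc x).comp hv)) _

theorem envelopeComp_toEnvelope_toRoelckeMaps [Infinite X] (hX : IsUltrahomogeneous X)
    (g h : X ≃o X) :
    envelopeComp hX (toEnvelope bmAct g) (toRoelckeMaps h) = toRoelckeMaps (g * h) :=
  Subtype.ext (funext fun x => smul_pt g (h x) 0)

theorem envelopeComp_injective [Infinite X] (hX : IsUltrahomogeneous X) :
    Function.Injective (envelopeComp hX) := by
  intro f f' h
  refine Subtype.ext (funext fun p => ?_)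
  have hr : ∀ (r : RoelckeMaps X) (x : X), f.1 (r.1 x) = f'.1 (r.1 x) := fun r x =>
    congrFun (congrArg Subtype.val (congrFun h r)) x
  by_cases hp : p ∈ base
  · obtain ⟨x, rfl⟩ := hp
    exact hr (toRoelckeMaps 1) x
  -- A constant map with value off `X` is a Roelcke map, so the action detects the value at `p`.
  · exact hr ⟨fun _ => p, ⟨fun _ _ _ => le_rfl, fun _ _ _ _ => hp⟩⟩ (Classical.arbitrary X)

theorem exists_homeomorph_apply_roelckeAct [Infinite X] (hX : IsUltrahomogeneous X) :
    ∃ Φ : RoelckeCompactification (X ≃o X) ≃ₜ RoelckeMaps X,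
      (∀ g, Φ (toRoelcke g) = toRoelckeMaps g) ∧
      ∀ g k, Φ (roelckeAct g k) = envelopeComp hX (toEnvelope bmAct g) (Φ k) := by
  obtain ⟨Φ, hΦ⟩ := exists_homeomorph_roelckeMaps hX
  refine ⟨Φ, hΦ, fun g k => ?_⟩
  refine congrFun (denseRange_toRoelcke.equalizer (g := fun k => Φ (roelckeAct g k))
    (h := fun k => envelopeComp hX (toEnvelope bmAct g) (Φ k))
    (Φ.continuous.comp (continuous_roelckeAct g)) ?_ (funext fun h => ?_)) k
  · exact continuous_envelopeComp_toEnvelope hX continuous_const Φ.continuous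
  · simp only [Function.comp_apply]
    rw [roelckeAct_toRoelcke (isRoelckePrecompact hX), hΦ, hΦ,
      envelopeComp_toEnvelope_toRoelckeMaps]

theorem isGCompactification_toRoelcke [Infinite X] (hX : IsUltrahomogeneous X) :
    IsGCompactification (toRoelcke (G := X ≃o X)) roelckeAct := by
  obtain ⟨Φ, hΦ, hact⟩ := exists_homeomorph_apply_roelckeAct hX
  have hd := isDenseEmbedding_toRoelckeMaps hX
  have he : toRoelcke (G := X ≃o X) = Φ.symm ∘ toRoelckeMaps :=
    funext fun g => by simp [← hΦ]
  refine ⟨Φ.symm.compactSpace, Φ.symm.t2Space, ⟨⟨?_, denseRange_toRoelcke⟩, ?_⟩, fun k => ?_,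
    fun g h k => ?_, roelckeAct_toRoelcke (isRoelckePrecompact hX), ?_⟩
  · rw [he]
    exact Φ.symm.isInducing.comp hd.isInducing
  · rw [he]
    exact Φ.symm.injective.comp hd.injective
  · refine Φ.injective ?_
    rw [hact]
    exact Subtype.ext (funext fun x => one_smul _ ((Φ k).1 x))
  · refine Φ.injective ?_
    rw [hact, hact, hact]
    exact Subtype.ext (funext fun x => mul_smul g h ((Φ k).1 x))
  · have hc : Continuous fun p : (X ≃o X) × RoelckeCompactification (X ≃o X) =>
        Φ.symm (envelopeComp hX (toEnvelope bmAct p.1) (Φ p.2)) :=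
      Φ.symm.continuous.comp (continuous_envelopeComp_toEnvelope hX continuous_fst
        (Φ.continuous.comp continuous_snd))
    simpa only [← hact, Homeomorph.symm_apply_apply] using hc

/-- The faithful action by composition is a continuous injection of a compact space into a Hausdorff
one. Its image is closed and the translations by `G` are dense in it, so it is the whole envelope.
-/
theorem compactificationEq_toEnvelope_roelckeAct [Infinite X] (hX : IsUltrahomogeneous X) :
    CompactificationEq (toEnvelope (roelckeAct (G := X ≃o X)))
      (toEnvelope (bmAct (X := X))) := by
  obtain ⟨Φ, hΦ, hact⟩ := exists_homeomorph_apply_roelckeAct hX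
  have := Φ.symm.t2Space
  let Ψ : envelope (bmAct (X := X)) →
      RoelckeCompactification (X ≃o X) → RoelckeCompactification (X ≃o X) :=
    fun f k => Φ.symm (envelopeComp hX f (Φ k))
  have hΨc : Continuous Ψ := continuous_pi fun k =>
    Φ.symm.continuous.comp (continuous_envelopeComp hX (Φ k))
  have hΨi : Function.Injective Ψ := fun f f' h => envelopeComp_injective hX <| funext fun r => by
    simpa [Ψ] using congrFun h (Φ.symm r)
  have hΨg : ∀ g, Ψ (toEnvelope bmAct g) = roelckeAct g := fun g => funext fun k => by
    simp only [Ψ, ← hact, Homeomorph.symm_apply_apply]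
  have hemb := hΨc.isClosedEmbedding hΨi
  have hrange : range Ψ = envelope (roelckeAct (G := X ≃o X)) := by
    refine subset_antisymm ?_ (closure_minimal ?_ hemb.isClosed_range)
    · refine (hΨc.range_subset_closure_image_dense
        (denseRange_toEnvelope (bmAct (X := X)))).trans (closure_mono ?_)
      rintro _ ⟨_, ⟨g, rfl⟩, rfl⟩
      exact ⟨g, (hΨg g).symm⟩
    · rintro _ ⟨g, rfl⟩
      exact ⟨_, hΨg g⟩
  let e := hemb.isEmbedding.toHomeomorph.trans (Homeomorph.setCongr hrange)
  refine ⟨e.symm, fun g => e.symm_apply_eq.2 (Subtype.ext (hΨg g).symm)⟩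

/-- The restriction to `X` of an element of the envelope of the action on `b_m X`. -/
def restrict [Infinite X] (hX : IsUltrahomogeneous X) (f : envelope (bmAct (X := X))) :
    RoelckeMaps X :=
  envelopeComp hX f (toRoelckeMaps 1)

theorem continuous_restrict [Infinite X] (hX : IsUltrahomogeneous X) :
    Continuous (restrict hX) :=
  continuous_envelopeComp hX _

theorem restrict_toEnvelope [Infinite X] (hX : IsUltrahomogeneous X) (g : X ≃o X) :
    restrict hX (toEnvelope bmAct g) = toRoelckeMaps g := by
  simp [restrict, envelopeComp_toEnvelope_toRoelckeMaps]

theorem compactificationLE_toRoelcke [Infinite X] (hX : IsUltrahomogeneous X) :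
    CompactificationLE (toRoelcke (G := X ≃o X)) (toEnvelope (bmAct (X := X))) := by
  obtain ⟨Φ, hΦ⟩ := exists_homeomorph_roelckeMaps hX
  exact ⟨Φ.symm ∘ restrict hX, Φ.symm.continuous.comp (continuous_restrict hX), fun g => by
    simp [restrict_toEnvelope, ← hΦ]⟩

theorem restrict_surjective [Infinite X] (hX : IsUltrahomogeneous X) :
    Function.Surjective (restrict hX) := by
  have hclosed : IsClosed (range (restrict hX)) :=
    (isCompact_range (continuous_restrict hX)).isClosed
  have hdense : DenseRange (restrict hX) := (denseRange_toRoelckeMaps hX).mono <| by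
    rintro _ ⟨g, rfl⟩
    exact ⟨_, restrict_toEnvelope hX g⟩
  exact range_eq_univ.1 (hclosed.closure_eq.symm.trans hdense.closure_range)

/-! ### Continuously ordered chains. -/

theorem isProperGap_of_notMem_triplePoints [DenselyOrdered X] {p : BMax X}
    (hp : p ∉ triplePoints X) (hbot : p ≠ ⊥) (htop : p ≠ ⊤) :
    IsProperGap {x | pt x 0 < p} {x | p < pt x 0} := by
  have hb := notMem_base_of_notMem_triplePoints hp
  have below := fun l => exists_lt_pt_lt' (b := l) hb (ne_pt_of_notMem_triplePoints hp _)
  have above := fun u => exists_lt_pt_lt (b := u) hb (ne_pt_of_notMem_triplePoints hp _)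
  refine ⟨?_, ?_, ?_, ?_, ?_, ?_⟩
  · exact (below ⊥ (bot_lt_iff_ne_bot.2 hbot)).imp fun _ h => h.2
  · exact (above ⊤ (lt_top_iff_ne_top.2 htop)).imp fun _ h => h.1
  · exact eq_univ_of_forall fun x => (lt_or_gt_of_ne (ne_pt_of_notMem_base hb x)).symm
  · exact fun a ha b hb => pt_zero_lt_pt_zero.1 (lt_trans ha hb)
  · rintro ⟨a, ha, hmax⟩
    obtain ⟨z, haz, hz⟩ := below _ ha
    exact (pt_zero_lt_pt_zero.1 haz).not_ge (hmax hz)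
  · rintro ⟨b, hb, hmin⟩
    obtain ⟨z, hz, hzb⟩ := above _ hb
    exact (pt_zero_lt_pt_zero.1 hzb).not_ge (hmin hz)

/-- Without proper gaps only triples and the two ends remain; the ends are fixed, and the value at
`(x, 0)` determines those at `(x, -1)` and `(x, 1)`. -/
theorem eq_of_eqOn_base [DenselyOrdered X] (hc : IsContinuouslyOrdered X)
    {f f' : BMax X → BMax X} (hf : IsEnvelopeMap X f) (hf' : IsEnvelopeMap X f')
    (h : ∀ x, f (pt x 0) = f' (pt x 0)) : f = f' := by
  funext p
  by_cases hbot : p = ⊥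
  · rw [hbot, hf.map_bot, hf'.map_bot]
  by_cases htop : p = ⊤
  · rw [htop, hf.map_top, hf'.map_top]
  by_cases hp : p ∈ triplePoints X
  · obtain ⟨⟨x, j⟩, rfl⟩ := hp
    have hx := h x
    rcases hf.triples x with ⟨h₁, h₂, h₃⟩ | ⟨y, h₁, h₂, h₃⟩ <;>
      rcases hf'.triples x with ⟨k₁, k₂, k₃⟩ | ⟨z, k₁, k₂, k₃⟩
    · rcases j with _ | _ | _
      exacts [hx, h₁.trans (hx.trans k₁.symm), h₂.symm.trans (hx.trans k₂)]
    · exact absurd ⟨z, (hx.trans k₂).symm⟩ h₃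
    · exact absurd ⟨y, (hx.symm.trans h₂).symm⟩ k₃
    · obtain rfl : y = z := (pt_inj.1 (h₂.symm.trans (hx.trans k₂))).1
      rcases j with _ | _ | _
      exacts [hx, h₁.trans k₁.symm, h₃.trans k₃.symm]
  · exact absurd (isProperGap_of_notMem_triplePoints hp hbot htop) (hc.2 _ _)

theorem compactificationEq_of_isContinuouslyOrdered [Infinite X] (hX : IsUltrahomogeneous X)
    (hc : IsContinuouslyOrdered X) :
    CompactificationEq (toRoelcke (G := X ≃o X)) (toEnvelope (bmAct (X := X))) := by
  have := hX.denselyOrdered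
  obtain ⟨Φ, hΦ⟩ := exists_homeomorph_roelckeMaps hX
  have hinj : Function.Injective (restrict hX) := fun f f' h => Subtype.ext <|
    eq_of_eqOn_base hc ((envelope_bmAct_eq hX).le f.2) ((envelope_bmAct_eq hX).le f'.2)
      fun x => congrFun (congrArg Subtype.val h) x
  let e : envelope (bmAct (X := X)) ≃ₜ RoelckeMaps X := Continuous.homeoOfEquivCompactToT2
    (f := Equiv.ofBijective _ ⟨hinj, restrict_surjective hX⟩) (continuous_restrict hX)
  refine ⟨Φ.trans e.symm, fun g => ?_⟩
  rw [Homeomorph.trans_apply, hΦ]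
  exact e.symm_apply_eq.2 (restrict_toEnvelope hX g).symm

end BMax
theorem theorem4p8 {X : Type*} [LinearOrder X] [Infinite X] (hX : IsUltrahomogeneous X) :
    -- `e_{b_m X} G` is an Ellis compactification of `G = Aut X`, with composition of maps
    (∃ M : Monoid (envelope (bmAct (X := X))),
      (∀ f h : envelope (bmAct (X := X)), ((f * h : envelope (bmAct (X := X))) : BMax X → BMax X)
        = (f : BMax X → BMax X) ∘ (h : BMax X → BMax X)) ∧
      IsEllisCompactification (toEnvelope (bmAct (X := X)))) ∧
    -- it is the completion of `(G, R_Σ)`, `Σ` the finite subsets of `b_m X`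
    IsCompletionOf (stabilizerUniformity (X ≃o X) (BMax X)) (toEnvelope (bmAct (X := X))) ∧
    -- `G` is Roelcke precompact, `b_r G ≤ e_{b_m X} G` and `𝔈(b_r G) = e_{b_m X} G`
    IsRoelckePrecompact (X ≃o X) ∧
    IsGCompactification (toRoelcke (G := X ≃o X)) roelckeAct ∧
    CompactificationLE (toRoelcke (G := X ≃o X)) (toEnvelope (bmAct (X := X))) ∧
    CompactificationEq (toEnvelope (roelckeAct (G := X ≃o X))) (toEnvelope (bmAct (X := X))) ∧
    -- the description of `e_{b_m X} G`
    envelope (bmAct (X := X)) = {f | IsEnvelopeMap X f} ∧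
    -- the description of `b_r G`, in the topology of pointwise convergence
    (∃ Φ : RoelckeCompactification (X ≃o X) ≃ₜ {f : X → BMax X // IsRoelckeMap f},
      ∀ (g : X ≃o X) (x : X), (Φ (toRoelcke g) : X → BMax X) x = BMax.pt (g x) 0) ∧
    -- the case of a continuously ordered chain
    (IsContinuouslyOrdered X →
      CompactificationEq (toRoelcke (G := X ≃o X)) (toEnvelope (bmAct (X := X)))) := by
  obtain ⟨Φ, hΦ⟩ := BMax.exists_homeomorph_roelckeMaps hX
  exact ⟨⟨BMax.envelopeMonoid hX, fun _ _ => rfl, BMax.isEllisCompactification_toEnvelope hX⟩,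
    BMax.isCompletionOf_toEnvelope hX, BMax.isRoelckePrecompact hX,
    BMax.isGCompactification_toRoelcke hX, BMax.compactificationLE_toRoelcke hX,
    BMax.compactificationEq_toEnvelope_roelckeAct hX, BMax.envelope_bmAct_eq hX,
    ⟨Φ, fun g x => by rw [hΦ]; rfl⟩, BMax.compactificationEq_of_isContinuouslyOrdered hX⟩
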